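/- Let $U\subseteq\mathbb C$ be a domain (a non-empty connected open set). Let $\theta$ be a Grassmann variable ($\theta^2=0$), and let $\mathfrak d^1=\mathfrak d^1_0\oplus\mathfrak d^1_1$ be the Lie superalgebra of first-order differential operators acting on functions $a(z)+b(z)\theta$ with $a,b$ analytic on $U$, whose even elements are $f\partial_z+g\,\theta\partial_\theta+h$ and whose odd elements are $\theta\varphi\,\partial_z+\chi\,\partial_\theta+\omega\,\theta$, with coefficients analytic on $U$, and whose bracket is $[A,B]=AB-(-1)^{\deg A\deg B}BA$. For open sets $V,W\subseteq\mathbb C$, two spaces of such operators on $V$ and on $W$ are called equivalent if one is mapped onto the other by a single transformation $T\mapsto u\,T\,u^{-1}$, rewritten in the variables $\bar z=\psi(z)$, $\bar\theta=v(z)\theta$, where $\psi:V\to W$ is biholomorphic and $u,v$ are non-vanishing analytic functions on $V$. Let $\mathfrak s=\mathfrak s_0\oplus\mathfrak s_1$ be a finite-dimensional graded subalgebra of $\mathfrak d^1$ with $\mathfrak s_1\neq 0$. Call $z_0\in U$ regular if either $f\equiv 0$ for all $f\partial_z+g\,\theta\partial_\theta+h\in\mathfrak s_0$, or $f(z_0)\ne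 0$ for at least one of these operators. Then the non-regular points have no accumulation point in $U$, and every regular point $z_0$ has an open neighbourhood $V\subseteq U$ such that the restriction of $\mathfrak s_0$ to $V$ is equivalent to one of the following Lie algebras on some open set $W\subseteq\mathbb C$ (angle brackets denote the complex linear span, $\epsilon\in\{0,1\}$, and $\alpha,\beta,\gamma\in\mathbb C$ are constants): i) $\mathfrak s_0^0=\langle\epsilon\theta\partial_\theta+h_1(z),\ h_l(z)\mid 2\le l\le s\rangle$, where $s\ge 1$, $h_1,\dots,h_s$ are analytic on $W$ and $h_2,\dots,h_s$ are linearly independent; ii) $\mathfrak s_0^1=\langle\partial_z,\ \epsilon\theta\partial_\theta+\alpha z^{s_0+1},\ z^le^{\sigma z}\mid 0\le l\le s_\sigma,\ \sigma\in\Sigma\rangle$, where $\Sigma$ is a finite (possibly empty) set of complex numbers, $s_\sigma\ge 0$ are integers for $\sigma\in\Sigma$, $s_0=-1$ if $0\notin\Sigma$, and $\alpha=0$ if $\epsilon=0$; iii) $\mathfrak s_0^2=\langle\partial_z,\ z\partial_z+\alpha\theta\partial_\theta+\beta,\ \epsilon\theta\partial_\theta+\gamma,\ z^l\mid 0\le l\le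 s\rangle$, where $s\ge -1$ (no power $z^l$ is present if $s=-1$); iv) $\mathfrak s_0^3=\langle\partial_z,\ z\partial_z+\alpha\theta\partial_\theta+\beta,\ z^2\partial_z+2\alpha z\,\theta\partial_\theta+2\beta z,\ \epsilon\theta\partial_\theta+\gamma\rangle$, or the span of this space and the operator $1$. -/

import Mathlib

open TopologicalSpace

namespace SuperDiff

noncomputable section

/-- The algebra of analytic functions on an open set `U` of the complex line. -/
def holSubalgebra (U : Opens ℂ) : Subalgebra ℂ (U → ℂ) where
  carrier := {f | ∃ F : ℂ → ℂ, AnalyticOnNhd ℂ F (U : Set ℂ) ∧ ∀ x : U, f x = F x}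
  mul_mem' := by
    rintro f g ⟨F, hF, hf⟩ ⟨G, hG, hg⟩
    exact ⟨F * G, hF.mul hG, fun x => by simp [hf x, hg x]⟩
  add_mem' := by
    rintro f g ⟨F, hF, hf⟩ ⟨G, hG, hg⟩
    exact ⟨F + G, hF.add hG, fun x => by simp [hf x, hg x]⟩
  algebraMap_mem' := fun c => ⟨fun _ => c, analyticOnNhd_const, fun _ => rfl⟩

/-- The type of analytic functions on `U`. -/
def Hol (U : Opens ℂ) : Type := holSubalgebra U

instance instCommRingHol (U : Opens ℂ) : CommRing (Hol U) :=
  inferInstanceAs (CommRing (holSubalgebra U))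

instance instAlgebraHol (U : Opens ℂ) : Algebra ℂ (Hol U) :=
  inferInstanceAs (Algebra ℂ (holSubalgebra U))

instance instCoeFunHol (U : Opens ℂ) : CoeFun (Hol U) fun _ => U → ℂ := ⟨Subtype.val⟩

theorem Hol.ext {U : Opens ℂ} {f g : Hol U} (h : ∀ x : U, f x = g x) : f = g :=
  Subtype.ext (funext h)

/-- Extension by zero of a function on `U`. -/
def extendZero {U : Opens ℂ} (f : U → ℂ) : ℂ → ℂ := Function.extend Subtype.val f 0

theorem extendZero_apply {U : Opens ℂ} (f : U → ℂ) (x : U) : extendZero f x = f x :=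
  Subtype.val_injective.extend_apply f 0 x

theorem analyticOnNhd_extendZero {U : Opens ℂ} (f : Hol U) :
    AnalyticOnNhd ℂ (extendZero ⇑f) (U : Set ℂ) := by
  obtain ⟨f, F, hF, hf⟩ := f
  refine hF.congr U.isOpen (fun x hx => ?_)
  rw [← hf ⟨x, hx⟩]
  exact (extendZero_apply f ⟨x, hx⟩).symm

theorem extendZero_add {U : Opens ℂ} (f g : U → ℂ) :
    extendZero (f + g) = extendZero f + extendZero g := by
  have := (Function.extend_add (Subtype.val : U → ℂ) f g 0 0)
  simpa [extendZero] using this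

theorem extendZero_smul {U : Opens ℂ} (c : ℂ) (f : U → ℂ) :
    extendZero (c • f) = c • extendZero f := by
  have := (Function.extend_smul c (Subtype.val : U → ℂ) f 0)
  simpa [extendZero] using this

/-- The complex derivative of analytic functions on `U`. -/
def derivHol (U : Opens ℂ) : Hol U →ₗ[ℂ] Hol U where
  toFun f := ⟨fun x => deriv (extendZero ⇑f) x,
    deriv (extendZero ⇑f), (analyticOnNhd_extendZero f).deriv, fun _ => rfl⟩
  map_add' f g := by
    apply Hol.ext
    intro x
    have hf := (analyticOnNhd_extendZero f x x.2).differentiableAt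
    have hg := (analyticOnNhd_extendZero g x x.2).differentiableAt
    change deriv (extendZero (⇑f + ⇑g)) x = _
    rw [extendZero_add]
    exact deriv_add hf hg
  map_smul' c f := by
    apply Hol.ext
    intro x
    have hf := (analyticOnNhd_extendZero f x x.2).differentiableAt
    change deriv (extendZero (c • ⇑f)) x = _
    rw [extendZero_smul]
    exact deriv_const_smul c hf

/-- The coordinate function `z`. -/
def coord (U : Opens ℂ) : Hol U := ⟨fun x => x, id, analyticOnNhd_id, fun _ => rfl⟩

/-- The function `exp (σ z)`. -/
def expFun (U : Opens ℂ) (σ : ℂ) : Hol U :=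
  ⟨fun x => Complex.exp (σ * x), fun z => Complex.exp (σ * z),
    (analyticOnNhd_const.mul analyticOnNhd_id).cexp, fun _ => rfl⟩

/-- Analytic functions on `U` with values in the Grassmann algebra on one generator `θ`:
the pair `(a, b)` stands for `a(z) + b(z) θ`. -/
abbrev SuperFun (U : Opens ℂ) : Type := Hol U × Hol U

/-- Linear operators on the space of Grassmann-valued analytic functions; the product is
composition. -/
abbrev Op (U : Opens ℂ) : Type := Module.End ℂ (SuperFun U)

/-- Multiplication by the analytic function `h`. -/
def mulOp {U : Opens ℂ} (h : Hol U) : Op U :=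
  (LinearMap.mulLeft ℂ h).prodMap (LinearMap.mulLeft ℂ h)

/-- The operator `∂_z`. -/
def dz (U : Opens ℂ) : Op U := (derivHol U).prodMap (derivHol U)

/-- Multiplication by `θ`: `a + b θ ↦ a θ`. -/
def theta (U : Opens ℂ) : Op U :=
  (LinearMap.inr ℂ (Hol U) (Hol U)).comp (LinearMap.fst ℂ (Hol U) (Hol U))

/-- The operator `∂_θ`: `a + b θ ↦ b`. -/
def dtheta (U : Opens ℂ) : Op U :=
  (LinearMap.inl ℂ (Hol U) (Hol U)).comp (LinearMap.snd ℂ (Hol U) (Hol U))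

/-- The even operator `f ∂_z + g θ ∂_θ + h`. -/
def evenOp {U : Opens ℂ} (f g h : Hol U) : Op U :=
  mulOp f * dz U + mulOp g * theta U * dtheta U + mulOp h

/-- The odd operator `θ φ ∂_z + χ ∂_θ + ω θ`. -/
def oddOp {U : Opens ℂ} (φ χ ω : Hol U) : Op U :=
  theta U * mulOp φ * dz U + mulOp χ * dtheta U + mulOp ω * theta U

theorem mulOp_add {U : Opens ℂ} (f g : Hol U) : mulOp (f + g) = mulOp f + mulOp g := by
  apply LinearMap.ext
  rintro ⟨a, b⟩
  simp [mulOp, add_mul]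

theorem mulOp_smul {U : Opens ℂ} (c : ℂ) (f : Hol U) : mulOp (c • f) = c • mulOp f := by
  apply LinearMap.ext
  rintro ⟨a, b⟩
  simp [mulOp]

theorem mulOp_zero {U : Opens ℂ} : mulOp (0 : Hol U) = 0 := by
  simpa using mulOp_smul (0 : ℂ) (0 : Hol U)

/-- The even subspace of the Lie superalgebra of first-order operators on `U`. -/
def evenSpace (U : Opens ℂ) : Submodule ℂ (Op U) where
  carrier := {T | ∃ f g h : Hol U, T = evenOp f g h}
  zero_mem' := ⟨0, 0, 0, by simp [evenOp, mulOp_zero]⟩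
  add_mem' := by
    rintro _ _ ⟨f, g, h, rfl⟩ ⟨f', g', h', rfl⟩
    refine ⟨f + f', g + g', h + h', ?_⟩
    simp only [evenOp, mulOp_add, add_mul]
    abel
  smul_mem' := by
    rintro c _ ⟨f, g, h, rfl⟩
    exact ⟨c • f, c • g, c • h, by simp [evenOp, mulOp_smul]⟩

/-- The odd subspace of the Lie superalgebra of first-order operators on `U`. -/
def oddSpace (U : Opens ℂ) : Submodule ℂ (Op U) where
  carrier := {T | ∃ φ χ ω : Hol U, T = oddOp φ χ ω}
  zero_mem' := ⟨0, 0, 0, by simp [oddOp, mulOp_zero]⟩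
  add_mem' := by
    rintro _ _ ⟨f, g, h, rfl⟩ ⟨f', g', h', rfl⟩
    refine ⟨f + f', g + g', h + h', ?_⟩
    simp only [oddOp, mulOp_add, add_mul, mul_add]
    abel
  smul_mem' := by
    rintro c _ ⟨f, g, h, rfl⟩
    exact ⟨c • f, c • g, c • h, by simp [oddOp, mulOp_smul]⟩

/-- The space `𝔡¹` of first-order operators with coefficients analytic on `U`. -/
def firstOrder (U : Opens ℂ) : Submodule ℂ (Op U) := evenSpace U ⊔ oddSpace U

/-- The even part of a subspace of `𝔡¹`. -/
def evenPart {U : Opens ℂ} (s : Submodule ℂ (Op U)) : Submodule ℂ (Op U) := s ⊓ evenSpace U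

/-- The odd part of a subspace of `𝔡¹`. -/
def oddPart {U : Opens ℂ} (s : Submodule ℂ (Op U)) : Submodule ℂ (Op U) := s ⊓ oddSpace U

/-- `s` is a graded subalgebra of the Lie superalgebra `𝔡¹`: it is a subspace of `𝔡¹` that is
spanned by its even and odd parts and is closed under `[A, B] = AB - (-1)^(deg A deg B) BA`. -/
structure IsGradedSubalgebra {U : Opens ℂ} (s : Submodule ℂ (Op U)) : Prop where
  graded : s = evenPart s ⊔ oddPart s
  even_even : ∀ A ∈ evenPart s, ∀ B ∈ evenPart s, A * B - B * A ∈ s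
  even_odd : ∀ A ∈ evenPart s, ∀ B ∈ oddPart s, A * B - B * A ∈ s
  odd_odd : ∀ A ∈ oddPart s, ∀ B ∈ oddPart s, A * B + B * A ∈ s

/-- Restriction of analytic functions to a smaller open set. -/
def resHol {U V : Opens ℂ} (hVU : V ≤ U) : Hol U →ₗ[ℂ] Hol V where
  toFun f := ⟨fun x => f ⟨x, hVU x.2⟩, by
    obtain ⟨f, F, hF, hf⟩ := f
    exact ⟨F, hF.mono hVU, fun x => hf ⟨x, hVU x.2⟩⟩⟩
  map_add' _ _ := rfl
  map_smul' _ _ := rfl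

/-- Restriction of Grassmann-valued analytic functions to a smaller open set. -/
def resFun {U V : Opens ℂ} (hVU : V ≤ U) : SuperFun U →ₗ[ℂ] SuperFun V :=
  (resHol hVU).prodMap (resHol hVU)

/-- Restriction of a space of first-order operators on `U` to a smaller open set `V`. A first-order
operator on `V` is the restriction of `T` if it is compatible with `T` and the restriction of
functions; it is then the operator whose coefficients are those of `T` restricted to `V`. -/
def restrictOps {U V : Opens ℂ} (hVU : V ≤ U) (L : Submodule ℂ (Op U)) : Submodule ℂ (Op V) where
  carrier := {S | S ∈ firstOrder V ∧ ∃ T ∈ L, S ∘ₗ resFun hVU = resFun hVU ∘ₗ T}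
  zero_mem' := ⟨zero_mem _, 0, zero_mem _, by simp⟩
  add_mem' := by
    rintro S S' ⟨hS, T, hT, h⟩ ⟨hS', T', hT', h'⟩
    exact ⟨add_mem hS hS', T + T', add_mem hT hT', by
      rw [LinearMap.add_comp, LinearMap.comp_add, h, h']⟩
  smul_mem' := by
    rintro c S ⟨hS, T, hT, h⟩
    exact ⟨Submodule.smul_mem _ c hS, c • T, Submodule.smul_mem _ c hT, by
      rw [LinearMap.smul_comp, LinearMap.comp_smul, h]⟩

/-- Composition `f ↦ f ∘ ψ` with an analytic map `ψ : W → V`. -/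
def compHol {V W : Opens ℂ} (ψ : W → V) (hψ : (fun w => (ψ w : ℂ)) ∈ holSubalgebra W) :
    Hol V →ₗ[ℂ] Hol W where
  toFun f := ⟨fun w => f (ψ w), by
    obtain ⟨f, F, hF, hf⟩ := f
    obtain ⟨Ψ, hΨ, h⟩ := hψ
    refine ⟨F ∘ Ψ, hF.comp hΨ (fun w hw => ?_), fun w => ?_⟩
    · rw [← h ⟨w, hw⟩]
      exact (ψ ⟨w, hw⟩).2
    · rw [Function.comp_apply, ← h w]
      exact hf (ψ w)⟩
  map_add' _ _ := rfl
  map_smul' _ _ := rfl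

/-- The data of an equivalence transformation: a change of variables `z' = φ(z)`, `θ' = β(z) θ`
with `φ : V → W` biholomorphic, and a gauge factor `α(z)`. The functions `α` and `β` are units of
the algebra of analytic functions, that is, non-vanishing analytic functions. -/
structure Transformation (V W : Opens ℂ) where
  φ : V ≃ W
  analytic_φ : (fun z => (φ z : ℂ)) ∈ holSubalgebra V
  analytic_symm : (fun w => (φ.symm w : ℂ)) ∈ holSubalgebra W
  α : (Hol V)ˣ
  β : (Hol V)ˣ

/-- The change of the even variable on functions, `a ↦ a ∘ φ⁻¹`. -/
def Transformation.compEquiv {V W : Opens ℂ} (τ : Transformation V W) : Hol V ≃ₗ[ℂ] Hol W :=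
  LinearEquiv.ofLinearMap (compHol τ.φ.symm τ.analytic_symm) (compHol τ.φ τ.analytic_φ)
    (by
      refine LinearMap.ext fun f => Hol.ext fun w => ?_
      exact congrArg (fun x => f x) (τ.φ.apply_symm_apply w))
    (by
      refine LinearMap.ext fun f => Hol.ext fun z => ?_
      exact congrArg (fun x => f x) (τ.φ.symm_apply_apply z))

/-- The action on Grassmann-valued functions: `F = a + b θ` is multiplied by `α` and then rewritten
in the variables `z' = φ(z)`, `θ' = β(z) θ`, which gives
`(α a) ∘ φ⁻¹ + ((α β⁻¹ b) ∘ φ⁻¹) θ'`. -/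
def Transformation.funEquiv {V W : Opens ℂ} (τ : Transformation V W) :
    SuperFun V ≃ₗ[ℂ] SuperFun W :=
  LinearEquiv.prodCongr
    ((DistribMulAction.toLinearEquiv ℂ (Hol V) τ.α).trans τ.compEquiv)
    ((DistribMulAction.toLinearEquiv ℂ (Hol V) (τ.α * τ.β⁻¹)).trans τ.compEquiv)

/-- Two spaces of operators are equivalent if one fixed transformation maps one onto the other,
an operator `T` being mapped to its conjugate by the action on functions. -/
def Equivalent {V W : Opens ℂ} (L : Submodule ℂ (Op V)) (L' : Submodule ℂ (Op W)) : Prop :=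
  ∃ τ : Transformation V W, L' = L.map (τ.funEquiv.conj : Op V →ₗ[ℂ] Op W)

/-- `⟨ε θ∂_θ + h₁ ; h_l⟩` with finitely many (possibly no) linearly independent functions `h_l`. -/
def IsType0 {W : Opens ℂ} (L : Submodule ℂ (Op W)) : Prop :=
  ∃ (ε : ℂ) (h₁ : Hol W) (n : ℕ) (h : Fin n → Hol W),
    (ε = 0 ∨ ε = 1) ∧ LinearIndependent ℂ h ∧
    L = Submodule.span ℂ
      ({ε • (theta W * dtheta W) + mulOp h₁} ∪ Set.range fun l => mulOp (h l))

/-- `⟨∂_z ; ε θ∂_θ + α z^(s₀+1), z^l e^(σz) | 0 ≤ l ≤ s_σ, σ ∈ S⟩`, where `s₀ = -1` if `0 ∉ S`. -/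
def IsType1 {W : Opens ℂ} (L : Submodule ℂ (Op W)) : Prop :=
  ∃ (ε α : ℂ) (S : Finset ℂ) (s : ℂ → ℕ),
    (ε = 0 ∨ ε = 1) ∧ (ε = 0 → α = 0) ∧
    L = Submodule.span ℂ
      ({dz W,
        ε • (theta W * dtheta W) + α • mulOp (coord W ^ (if (0 : ℂ) ∈ S then s 0 + 1 else 0))} ∪
        {T | ∃ σ ∈ S, ∃ l ≤ s σ, T = mulOp (coord W ^ l * expFun W σ)})

/-- `⟨∂_z, z∂_z + α θ∂_θ + β ; ε θ∂_θ + γ, z^l | 0 ≤ l ≤ s⟩`, with `n = s + 1`, so that `n = 0`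
if no power of `z` is present. -/
def IsType2 {W : Opens ℂ} (L : Submodule ℂ (Op W)) : Prop :=
  ∃ (ε α β γ : ℂ) (n : ℕ),
    (ε = 0 ∨ ε = 1) ∧
    L = Submodule.span ℂ
      ({dz W,
        mulOp (coord W) * dz W + α • (theta W * dtheta W) + β • (1 : Op W),
        ε • (theta W * dtheta W) + γ • (1 : Op W)} ∪
        {T | ∃ l < n, T = mulOp (coord W ^ l)})

/-- `⟨∂_z, z∂_z + α θ∂_θ + β, z²∂_z + 2α z θ∂_θ + 2β z ; ε θ∂_θ + γ, 1⟩`, where the proposition `p`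
says whether the generator `1` is present. -/
def IsType3 {W : Opens ℂ} (L : Submodule ℂ (Op W)) : Prop :=
  ∃ (ε α β γ : ℂ) (p : Prop),
    (ε = 0 ∨ ε = 1) ∧
    L = Submodule.span ℂ
      ({dz W,
        mulOp (coord W) * dz W + α • (theta W * dtheta W) + β • (1 : Op W),
        mulOp (coord W ^ 2) * dz W + (2 * α) • (mulOp (coord W) * theta W * dtheta W)
          + (2 * β) • mulOp (coord W),
        ε • (theta W * dtheta W) + γ • (1 : Op W)} ∪
        {T | p ∧ T = 1})

/-- `z₀` is a regular point of the space `L` of even operators: the vector fields `f ∂_z` that occur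
in the elements `f ∂_z + g θ∂_θ + h` of `L` do not all vanish at `z₀`, unless they are all zero. -/
def IsRegularPoint {U : Opens ℂ} (L : Submodule ℂ (Op U)) (z₀ : U) : Prop :=
  (∀ f g h : Hol U, evenOp f g h ∈ L → f = 0) ∨
    ∃ f g h : Hol U, evenOp f g h ∈ L ∧ f z₀ ≠ 0

end

end SuperDiff

namespace SuperDiff

noncomputable section

/-! ### Analytic functions on an open set -/

section Hol

variable {U : Opens ℂ}

/-! An even operator is handled through its coefficient triple `(f, g, h)`. On triples the bracket
is that of vector fields `f ∂_z` acting by differentiation on pairs of functions `(g, h)`: the terms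
with `f = 0` form an abelian ideal, and the first coefficients form a finite-dimensional Lie algebra
of vector fields on a domain.

The odd part is used only once. Bracketing an element with `f = 0` against odd operators multiplies
their leading coefficient by `±g`, so `g` acts by multiplication on a nonzero finite-dimensional
space of functions. An eigenvector there gives `(g - c) k = 0` with `k ≠ 0`, hence `g` is constant
(`isAdmissible_coeffSpace`). The ideal `f = 0` therefore consists of multiplications by functions,
together with at most one further generator `θ∂_θ + h₁`. This settles the case without vector
fields.

Otherwise `exists_affine_pair` shows that near a regular point the vector fields are either all
proportional to one, or contain a two-dimensional affine pair. The coordinate that straightens the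
nonvanishing field to `∂_z` turns the other member of the pair into `z ∂_z`
(`IsAdmissible.rectify`). On a disc, a gauge factor and a rescaling of `θ` remove `g` and `h` from
the operator over `∂_z`.

With `∂_z` alone, the multiplication functions form a finite-dimensional space stable under
differentiation, hence a span of exponential monomials, which gives type 1. With `z ∂_z` as well,
the relation `[z∂_z, ∂_z] = -∂_z` makes differentiation nilpotent, so both the functions and the
vector fields are all polynomials up to some degree. Closure under the bracket bounds the degree of
the vector fields by 2, and degree 2 leaves room only for constant functions; these are types 2 and
3.

Non-regular points are zeros of a single nonzero analytic function, hence isolated. -/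

theorem Hol.add_apply (f g : Hol U) (x : U) : (f + g) x = f x + g x := rfl

theorem Hol.sub_apply (f g : Hol U) (x : U) : (f - g) x = f x - g x := rfl

theorem Hol.mul_apply (f g : Hol U) (x : U) : (f * g) x = f x * g x := rfl

theorem Hol.smul_apply (c : ℂ) (f : Hol U) (x : U) : (c • f) x = c * f x := rfl

theorem Hol.zero_apply (x : U) : (0 : Hol U) x = 0 := rfl

theorem Hol.one_apply (x : U) : (1 : Hol U) x = 1 := rfl

theorem coord_apply (x : U) : coord U x = x := rfl

theorem extendZero_eventuallyEq (f : Hol U) {F : ℂ → ℂ} (hF : ∀ x : U, f x = F x) (x : U) :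
    extendZero ⇑f =ᶠ[nhds (x : ℂ)] F := by
  filter_upwards [U.isOpen.mem_nhds x.2] with y hy
  rw [← hF ⟨y, hy⟩]
  exact extendZero_apply _ ⟨y, hy⟩

theorem hasDerivAt_extendZero (f : Hol U) (x : U) :
    HasDerivAt (extendZero ⇑f) (derivHol U f x) x :=
  (analyticOnNhd_extendZero f x x.2).differentiableAt.hasDerivAt

theorem derivHol_apply_of_hasDerivAt {f : Hol U} {F : ℂ → ℂ} (hF : ∀ x : U, f x = F x) {x : U}
    {d : ℂ} (hd : HasDerivAt F d x) : derivHol U f x = d :=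
  (hasDerivAt_extendZero f x).unique (hd.congr_of_eventuallyEq (extendZero_eventuallyEq f hF x))

theorem derivHol_mul (f g : Hol U) :
    derivHol U (f * g) = derivHol U f * g + f * derivHol U g := by
  refine Hol.ext fun x => derivHol_apply_of_hasDerivAt (F := extendZero ⇑f * extendZero ⇑g)
    (fun y => ?_) ?_
  · rw [Pi.mul_apply, extendZero_apply, extendZero_apply]
    rfl
  · have := (hasDerivAt_extendZero f x).mul (hasDerivAt_extendZero g x)
    rwa [extendZero_apply, extendZero_apply] at this

theorem derivHol_one : derivHol U 1 = 0 :=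
  Hol.ext fun _ => derivHol_apply_of_hasDerivAt (F := fun _ => 1) (fun _ => rfl)
    (hasDerivAt_const _ _)

theorem derivHol_coord : derivHol U (coord U) = 1 :=
  Hol.ext fun _ => derivHol_apply_of_hasDerivAt (F := id) (fun _ => rfl) (hasDerivAt_id _)

theorem derivHol_coord_pow (n : ℕ) :
    derivHol U (coord U ^ n) = (n : ℂ) • coord U ^ (n - 1) :=
  Hol.ext fun _ => derivHol_apply_of_hasDerivAt (F := fun z => z ^ n) (fun _ => rfl)
    (hasDerivAt_pow n _)

theorem derivHol_expFun (σ : ℂ) : derivHol U (expFun U σ) = σ • expFun U σ := by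
  refine Hol.ext fun x => derivHol_apply_of_hasDerivAt (F := fun z => Complex.exp (σ * z))
    (fun _ => rfl) ?_
  have := ((hasDerivAt_id (x : ℂ)).const_mul σ).cexp
  rw [mul_one, mul_comm] at this
  exact this

theorem expFun_zero : expFun U 0 = 1 :=
  Hol.ext fun x => by change Complex.exp (0 * x) = 1; simp

theorem expFun_mul_expFun_neg (σ : ℂ) : expFun U σ * expFun U (-σ) = 1 :=
  Hol.ext fun x => by
    change Complex.exp (σ * x) * Complex.exp (-σ * x) = 1
    rw [← Complex.exp_add]
    simp

theorem Hol.eq_zero_of_eventually (hU : IsPreconnected (U : Set ℂ)) {f : Hol U} (x : U)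
    (h : ∀ᶠ z in nhds (x : ℂ), extendZero ⇑f z = 0) : f = 0 := by
  refine Hol.ext fun y => ?_
  rw [← extendZero_apply ⇑f y]
  exact (analyticOnNhd_extendZero f).eqOn_zero_of_preconnected_of_eventuallyEq_zero hU x.2 h y.2

theorem Hol.eq_zero_or_eq_zero_of_mul (hU : IsPreconnected (U : Set ℂ)) {f g : Hol U}
    (h : f * g = 0) : f = 0 ∨ g = 0 := by
  have := (analyticOnNhd_extendZero f).eq_zero_or_eq_zero_of_mul_eq_zero
    (analyticOnNhd_extendZero g) (fun z hz => by
      have e1 := extendZero_apply ⇑f ⟨z, hz⟩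
      have e2 := extendZero_apply ⇑g ⟨z, hz⟩
      simp only at e1 e2
      rw [e1, e2, ← Hol.mul_apply, h, Hol.zero_apply]) hU
  refine this.imp (fun h0 => Hol.ext fun y => ?_) (fun h0 => Hol.ext fun y => ?_)
  · rw [← extendZero_apply ⇑f y]; exact h0 y y.2
  · rw [← extendZero_apply ⇑g y]; exact h0 y y.2

theorem Hol.exists_eq_smul_one_of_derivHol_eq_zero (hU : IsPreconnected (U : Set ℂ)) {f : Hol U}
    (h : derivHol U f = 0) : ∃ c : ℂ, f = c • (1 : Hol U) := by
  obtain ⟨c, hc⟩ := U.isOpen.exists_is_const_of_deriv_eq_zero hU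
    (analyticOnNhd_extendZero f).differentiableOn (fun x hx => by
      have := congrArg (fun k : Hol U => k ⟨x, hx⟩) h
      exact this)
  refine ⟨c, Hol.ext fun x => ?_⟩
  rw [← extendZero_apply ⇑f x, hc x x.2, Hol.smul_apply, Hol.one_apply, mul_one]

theorem Hol.exists_derivHol_eq_of_ball {c : ℂ} {r : ℝ} (hU : (U : Set ℂ) = Metric.ball c r)
    (f : Hol U) : ∃ F : Hol U, derivHol U F = f := by
  have hd : DifferentiableOn ℂ (extendZero ⇑f) (Metric.ball c r) :=
    hU ▸ (analyticOnNhd_extendZero f).differentiableOn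
  obtain ⟨F, hF⟩ := hd.isExactOn_ball
  have hFd : DifferentiableOn ℂ F (U : Set ℂ) := fun z hz =>
    (hF z (hU ▸ hz)).differentiableAt.differentiableWithinAt
  refine ⟨⟨fun x => F x, F, hFd.analyticOnNhd U.isOpen, fun _ => rfl⟩, Hol.ext fun x => ?_⟩
  rw [← extendZero_apply ⇑f x]
  exact derivHol_apply_of_hasDerivAt (fun _ => rfl) (hF x (hU ▸ x.2))

theorem Hol.isUnit_of_ne_zero {f : Hol U} (h : ∀ x : U, f x ≠ 0) :
    ∃ u : (Hol U)ˣ, (u : Hol U) = f := by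
  have hg : (fun x : U => (f x)⁻¹) ∈ holSubalgebra U :=
    ⟨fun z => (extendZero ⇑f z)⁻¹, (analyticOnNhd_extendZero f).inv (fun z hz => by
      rw [show z = ((⟨z, hz⟩ : U) : ℂ) from rfl, extendZero_apply]
      exact h _), fun x => (congrArg Inv.inv (extendZero_apply ⇑f x)).symm⟩
  refine ⟨⟨f, ⟨_, hg⟩, Hol.ext fun x => mul_inv_cancel₀ (h x),
    Hol.ext fun x => inv_mul_cancel₀ (h x)⟩, rfl⟩

/-- The exponential of an analytic function. -/
def Hol.cexp (p : Hol U) : Hol U :=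
  ⟨fun x => Complex.exp (p x), fun z => Complex.exp (extendZero ⇑p z),
    (analyticOnNhd_extendZero p).cexp,
    fun x => (congrArg Complex.exp (extendZero_apply ⇑p x)).symm⟩

theorem Hol.derivHol_cexp (p : Hol U) : derivHol U p.cexp = derivHol U p * p.cexp := by
  refine Hol.ext fun x => derivHol_apply_of_hasDerivAt
    (F := fun z => Complex.exp (extendZero ⇑p z)) (fun y => ?_) ?_
  · rw [extendZero_apply]; rfl
  · have := (hasDerivAt_extendZero p x).cexp
    rw [extendZero_apply, mul_comm] at this
    exact this

theorem Hol.exists_unit_cexp (p : Hol U) : ∃ u : (Hol U)ˣ, (u : Hol U) = p.cexp :=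
  Hol.isUnit_of_ne_zero fun _ => Complex.exp_ne_zero _

theorem derivHol_resHol {V : Opens ℂ} (hVU : V ≤ U) (f : Hol U) :
    derivHol V (resHol hVU f) = resHol hVU (derivHol U f) :=
  Hol.ext fun x => derivHol_apply_of_hasDerivAt (F := extendZero ⇑f)
    (fun y => (extendZero_apply ⇑f ⟨y, hVU y.2⟩).symm) (hasDerivAt_extendZero f ⟨x, hVU x.2⟩)

theorem resHol_mul {V : Opens ℂ} (hVU : V ≤ U) (f g : Hol U) :
    resHol hVU (f * g) = resHol hVU f * resHol hVU g := rfl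

theorem resHol_eq_zero (hU : IsPreconnected (U : Set ℂ)) {V : Opens ℂ} (hVU : V ≤ U)
    (x : V) {f : Hol U} (h : resHol hVU f = 0) : f = 0 := by
  refine Hol.eq_zero_of_eventually hU ⟨x, hVU x.2⟩ ?_
  filter_upwards [V.isOpen.mem_nhds x.2] with z hz
  have h1 := congrArg (fun k : Hol V => k ⟨z, hz⟩) h
  have h2 := extendZero_apply ⇑f ⟨z, hVU hz⟩
  exact h2.trans h1

end Hol

/-! ### Coefficients of even operators -/

section Coeff

variable {U : Opens ℂ}

theorem mulOp_apply (h : Hol U) (p : SuperFun U) : mulOp h p = (h * p.1, h * p.2) := rfl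

theorem evenOp_apply (f g h : Hol U) (p : SuperFun U) :
    evenOp f g h p =
      (f * derivHol U p.1 + h * p.1, f * derivHol U p.2 + g * p.2 + h * p.2) := by
  change (f * derivHol U p.1 + g * 0 + h * p.1, f * derivHol U p.2 + g * p.2 + h * p.2) = _
  rw [mul_zero, add_zero]

theorem oddOp_apply (φ χ ω : Hol U) (p : SuperFun U) :
    oddOp φ χ ω p = (χ * p.2, φ * derivHol U p.1 + ω * p.1) := by
  change (0 + χ * p.2 + ω * 0, φ * derivHol U p.1 + χ * 0 + ω * p.1) = _
  rw [mul_zero, mul_zero, add_zero, zero_add, add_zero]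

/-- The coefficients `(f, g, h)` of the even operator `f ∂_z + g θ∂_θ + h`. -/
abbrev Coeff (U : Opens ℂ) : Type := Hol U × Hol U × Hol U

/-- The even operator with given coefficients. -/
def evenMap (U : Opens ℂ) : Coeff U →ₗ[ℂ] Op U where
  toFun x := evenOp x.1 x.2.1 x.2.2
  map_add' x y := by
    simp only [evenOp, mulOp_add, add_mul, Prod.fst_add, Prod.snd_add]
    abel
  map_smul' c x := by
    simp [evenOp, mulOp_smul]

theorem evenMap_apply (f g h : Hol U) : evenMap U (f, g, h) = evenOp f g h := rfl

/-- The odd operator with given coefficients. -/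
def oddMap (U : Opens ℂ) : Coeff U →ₗ[ℂ] Op U where
  toFun x := oddOp x.1 x.2.1 x.2.2
  map_add' x y := by
    simp only [oddOp, mulOp_add, add_mul, mul_add, Prod.fst_add, Prod.snd_add]
    abel
  map_smul' c x := by
    simp [oddOp, mulOp_smul]

/-- The coefficients of an operator are determined by its values on `1`, `θ` and `z`. -/
theorem eq_zero_of_evenOp_add_oddOp_eq_zero {f g h φ χ ω : Hol U}
    (e : ∀ p ∈ ({(1, 0), (0, 1), (coord U, 0)} : Set (SuperFun U)),
      evenOp f g h p + oddOp φ χ ω p = 0) :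
    (f = 0 ∧ g = 0 ∧ h = 0) ∧ φ = 0 ∧ χ = 0 ∧ ω = 0 := by
  have e1 := e (1, 0) (by simp)
  have e2 := e (0, 1) (by simp)
  have e3 := e (coord U, 0) (by simp)
  rw [evenOp_apply, oddOp_apply] at e1 e2 e3
  simp only [map_zero, derivHol_one, derivHol_coord, mul_zero, mul_one, add_zero, zero_add,
    Prod.mk_add_mk, Prod.mk_eq_zero] at e1 e2 e3
  obtain ⟨rfl, rfl⟩ := e1
  obtain ⟨rfl, h2⟩ := e2
  simp only [zero_mul, add_zero] at h2 e3
  obtain ⟨rfl, rfl⟩ := e3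
  exact ⟨⟨rfl, h2, rfl⟩, rfl, rfl, rfl⟩

theorem evenMap_injective : Function.Injective (evenMap U) := by
  rw [injective_iff_map_eq_zero]
  rintro ⟨f, g, h⟩ e
  obtain ⟨⟨rfl, rfl, rfl⟩, -⟩ :=
    eq_zero_of_evenOp_add_oddOp_eq_zero (f := f) (g := g) (h := h) (φ := 0) (χ := 0) (ω := 0)
      (fun p _ => by
        rw [← evenMap_apply, e, oddOp_apply]
        simp)
  rfl

theorem oddMap_injective : Function.Injective (oddMap U) := by
  rw [injective_iff_map_eq_zero]
  rintro ⟨f, g, h⟩ e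
  obtain ⟨-, rfl, rfl, rfl⟩ :=
    eq_zero_of_evenOp_add_oddOp_eq_zero (f := 0) (g := 0) (h := 0) (φ := f) (χ := g) (ω := h)
      (fun p _ => by
        rw [show oddOp f g h = 0 from e, evenOp_apply]
        simp)
  rfl

/-- The Lie bracket in terms of coefficients. -/
def bracket (x y : Coeff U) : Coeff U :=
  (x.1 * derivHol U y.1 - y.1 * derivHol U x.1,
    x.1 * derivHol U y.2.1 - y.1 * derivHol U x.2.1,
    x.1 * derivHol U y.2.2 - y.1 * derivHol U x.2.2)

theorem evenMap_bracket (x y : Coeff U) :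
    evenMap U (bracket x y) = evenMap U x * evenMap U y - evenMap U y * evenMap U x := by
  obtain ⟨f, g, h⟩ := x
  obtain ⟨f', g', h'⟩ := y
  refine LinearMap.ext fun p => ?_
  simp only [bracket, evenMap_apply, LinearMap.sub_apply, Module.End.mul_apply, evenOp_apply,
    Prod.mk_sub_mk, map_add, derivHol_mul]
  ext1 <;> simp only <;> ring

/-- This is how the odd part constrains the even one: up to sign, `g` multiplies the first nonzero
entry among `φ`, `χ`, `ω`, because the correction `φ h'` disappears once `φ = 0`. -/
theorem evenOp_oddOp_bracket (g h φ χ ω : Hol U) :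
    evenOp 0 g h * oddOp φ χ ω - oddOp φ χ ω * evenOp 0 g h =
      oddOp (g * φ) (-(g * χ)) (g * ω - φ * derivHol U h) := by
  refine LinearMap.ext fun p => ?_
  simp only [LinearMap.sub_apply, Module.End.mul_apply, evenOp_apply, oddOp_apply,
    Prod.mk_sub_mk, map_add, map_zero, derivHol_mul]
  ext1 <;> simp only <;> ring

theorem mem_evenSpace_iff {T : Op U} : T ∈ evenSpace U ↔ T ∈ LinearMap.range (evenMap U) :=
  ⟨fun ⟨f, g, h, e⟩ => ⟨(f, g, h), e.symm⟩, fun ⟨x, e⟩ => ⟨x.1, x.2.1, x.2.2, e.symm⟩⟩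

theorem evenMap_mem_evenSpace (x : Coeff U) : evenMap U x ∈ evenSpace U :=
  ⟨x.1, x.2.1, x.2.2, rfl⟩

/-- The coefficients of the elements of a space of even operators. -/
def coeffSpace (s : Submodule ℂ (Op U)) : Submodule ℂ (Coeff U) := s.comap (evenMap U)

theorem evenPart_eq_map (s : Submodule ℂ (Op U)) :
    evenPart s = (coeffSpace s).map (evenMap U) := by
  ext T
  constructor
  · rintro ⟨hT, hT'⟩
    obtain ⟨x, rfl⟩ := mem_evenSpace_iff.1 hT'
    exact ⟨x, hT, rfl⟩
  · rintro ⟨x, hx, rfl⟩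
    exact ⟨hx, evenMap_mem_evenSpace x⟩

/-- A space of coefficients is bracket-closed. -/
def IsBracketClosed (M : Submodule ℂ (Coeff U)) : Prop :=
  ∀ x ∈ M, ∀ y ∈ M, bracket x y ∈ M

theorem isBracketClosed_coeffSpace {s : Submodule ℂ (Op U)} (hs : IsGradedSubalgebra s) :
    IsBracketClosed (coeffSpace s) := fun x hx y hy => by
  change evenMap U _ ∈ s
  rw [evenMap_bracket]
  exact hs.even_even _ ⟨hx, evenMap_mem_evenSpace x⟩ _ ⟨hy, evenMap_mem_evenSpace y⟩

theorem finiteDimensional_comap {M N : Type*} [AddCommGroup M] [Module ℂ M] [AddCommGroup N]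
    [Module ℂ N] (s : Submodule ℂ N) [FiniteDimensional ℂ s] {F : M →ₗ[ℂ] N}
    (hF : Function.Injective F) : FiniteDimensional ℂ (s.comap F) := by
  refine Module.Finite.of_injective (F.restrict (p := s.comap F) (q := s) fun x hx => hx) ?_
  intro x y h
  exact Subtype.ext (hF (congrArg Subtype.val h))

instance finiteDimensional_coeffSpace (s : Submodule ℂ (Op U)) [FiniteDimensional ℂ s] :
    FiniteDimensional ℂ (coeffSpace s) := finiteDimensional_comap s evenMap_injective

/-- Restriction of coefficients. -/
def resCoeff {V : Opens ℂ} (hVU : V ≤ U) : Coeff U →ₗ[ℂ] Coeff V :=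
  (resHol hVU).prodMap ((resHol hVU).prodMap (resHol hVU))

theorem evenMap_resCoeff {V : Opens ℂ} (hVU : V ≤ U) (x : Coeff U) :
    evenMap V (resCoeff hVU x) ∘ₗ resFun hVU = resFun hVU ∘ₗ evenMap U x := by
  obtain ⟨f, g, h⟩ := x
  refine LinearMap.ext fun p => ?_
  change evenOp _ _ _ (resHol hVU p.1, resHol hVU p.2) = resFun hVU (evenOp _ _ _ _)
  rw [evenOp_apply, evenOp_apply, derivHol_resHol, derivHol_resHol]
  rfl

/-- A priori a restriction is only some first-order operator compatible with restriction of
functions. Coefficients are read off from the values on `1`, `θ` and `z`, and these functions extend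
to `U`, so the odd part must vanish and the even coefficients are the restricted ones. -/
theorem restrictOps_map_evenMap {V : Opens ℂ} (hVU : V ≤ U) (M : Submodule ℂ (Coeff U)) :
    restrictOps hVU (M.map (evenMap U)) = (M.map (resCoeff hVU)).map (evenMap V) := by
  ext S
  constructor
  · rintro ⟨hS, _, ⟨x, hx, rfl⟩, e⟩
    refine ⟨_, ⟨x, hx, rfl⟩, ?_⟩
    obtain ⟨_, ⟨f, g, h, rfl⟩, _, ⟨φ, χ, ω, rfl⟩, rfl⟩ := Submodule.mem_sup.1 hS
    rw [← evenMap_resCoeff] at e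
    set y := resCoeff hVU x
    have key := eq_zero_of_evenOp_add_oddOp_eq_zero (f := f - y.1) (g := g - y.2.1)
      (h := h - y.2.2) (φ := φ) (χ := χ) (ω := ω) (fun p hp => by
        obtain ⟨q, rfl⟩ : ∃ q, resFun hVU q = p := by
          rcases hp with rfl | rfl | rfl
          · exact ⟨(1, 0), rfl⟩
          · exact ⟨(0, 1), rfl⟩
          · exact ⟨(coord U, 0), rfl⟩
        have e' := LinearMap.congr_fun e q
        have e'' : evenMap V (f - y.1, g - y.2.1, h - y.2.2) =
            evenMap V (f, g, h) - evenMap V y := by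
          rw [← map_sub]; rfl
        rw [← evenMap_apply, e'', LinearMap.sub_apply]
        simp only [LinearMap.comp_apply, LinearMap.add_apply] at e'
        rw [← e', evenMap_apply]
        abel)
    obtain ⟨⟨h1, h2, h3⟩, rfl, rfl, rfl⟩ := key
    rw [sub_eq_zero] at h1 h2 h3
    subst h1 h2 h3
    simp [oddOp, mulOp_zero]
    rfl
  · rintro ⟨_, ⟨x, hx, rfl⟩, rfl⟩
    exact ⟨Submodule.mem_sup_left (evenMap_mem_evenSpace _), _, ⟨x, hx, rfl⟩,
      evenMap_resCoeff hVU x⟩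

theorem resCoeff_bracket {V : Opens ℂ} (hVU : V ≤ U) (x y : Coeff U) :
    resCoeff hVU (bracket x y) = bracket (resCoeff hVU x) (resCoeff hVU y) := by
  simp only [resCoeff, bracket, LinearMap.prodMap_apply, derivHol_resHol, map_sub, resHol_mul]

end Coeff

/-! ### Action of transformations on coefficients -/

section Transformation

variable {V W X : Opens ℂ}

/-- The pullback of functions `k ↦ k ∘ φ` along a transformation. -/
def Transformation.pull (τ : Transformation V W) : Hol W →ₗ[ℂ] Hol V :=
  compHol τ.φ τ.analytic_φ

theorem Transformation.pull_mul (τ : Transformation V W) (k l : Hol W) :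
    τ.pull (k * l) = τ.pull k * τ.pull l := rfl

theorem Transformation.pull_compEquiv (τ : Transformation V W) (k : Hol V) :
    τ.pull (τ.compEquiv k) = k := τ.compEquiv.symm_apply_apply k

theorem Transformation.pull_injective (τ : Transformation V W) : Function.Injective τ.pull :=
  τ.compEquiv.symm.injective

/-- The new even coordinate as an analytic function of the old one. -/
def Transformation.newCoord (τ : Transformation V W) : Hol V := ⟨_, τ.analytic_φ⟩

theorem Transformation.derivHol_pull (τ : Transformation V W) (k : Hol W) :
    derivHol V (τ.pull k) = τ.pull (derivHol W k) * derivHol V τ.newCoord := by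
  refine Hol.ext fun z => derivHol_apply_of_hasDerivAt
    (F := extendZero ⇑k ∘ extendZero ⇑τ.newCoord) (fun y => ?_) ?_
  · rw [Function.comp_apply, extendZero_apply ⇑τ.newCoord y]
    exact (extendZero_apply ⇑k (τ.φ y)).symm
  · refine HasDerivAt.comp (z : ℂ) ?_ (hasDerivAt_extendZero τ.newCoord z)
    rw [extendZero_apply ⇑τ.newCoord z]
    exact hasDerivAt_extendZero k (τ.φ z)

/-- The hypotheses are the transformation laws pulled back to `V` and cleared of denominators: `f
∂_z` moves as a vector field, `g` gains `f β'/β`, and `h` loses `f α'/α`. -/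
theorem Transformation.conj_evenOp (τ : Transformation V W) {f g h : Hol V} {f' g' h' : Hol W}
    (hf : τ.pull f' = f * derivHol V τ.newCoord)
    (hg : τ.pull g' * τ.β = g * τ.β + f * derivHol V τ.β)
    (hh : τ.pull h' * τ.α = h * τ.α - f * derivHol V τ.α) :
    τ.funEquiv.conj (evenOp f g h) = evenOp f' g' h' := by
  refine LinearMap.ext fun P => ?_
  obtain ⟨⟨a, b⟩, rfl⟩ := τ.funEquiv.surjective P
  rw [LinearEquiv.conj_apply_apply, LinearEquiv.symm_apply_apply, evenOp_apply, evenOp_apply]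
  have h1 : ∀ q : SuperFun V, τ.pull (τ.funEquiv q).1 = τ.α * q.1 := fun q =>
    τ.pull_compEquiv _
  have h2 : ∀ q : SuperFun V, τ.pull (τ.funEquiv q).2 = (τ.α * τ.β⁻¹ : (Hol V)ˣ) * q.2 :=
    fun q => τ.pull_compEquiv _
  have hγ : ((τ.α * τ.β⁻¹ : (Hol V)ˣ) : Hol V) * τ.β = τ.α := by
    rw [← Units.val_mul, inv_mul_cancel_right]
  have hDγ := congrArg (derivHol V) hγ
  rw [derivHol_mul] at hDγ
  have d1 := τ.derivHol_pull (τ.funEquiv (a, b)).1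
  have d2 := τ.derivHol_pull (τ.funEquiv (a, b)).2
  rw [h1, derivHol_mul] at d1
  rw [h2, derivHol_mul] at d2
  refine Prod.ext (τ.pull_injective ?_) (τ.pull_injective ?_)
  · simp only [h1, map_add, τ.pull_mul, hf]
    linear_combination f * d1 - a * hh
  · simp only [h2, map_add, τ.pull_mul, hf]
    set γ : Hol V := ((τ.α * τ.β⁻¹ : (Hol V)ˣ) : Hol V)
    -- The `θ`-component is multiplied by `α β⁻¹`. Multiplying the identity by the unit `α β` makes
    -- it a polynomial consequence of the hypotheses and the derivative of `γ β = α`.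
    have hcancel : ∀ x y : Hol V, x * (τ.α * τ.β) = y * (τ.α * τ.β) → x = y := fun x y e => by
      rw [← Units.val_mul] at e
      exact (Units.mul_left_inj _).1 e
    apply hcancel
    linear_combination (f * d2 * τ.α * τ.β - γ * b * τ.β * hh - γ * b * τ.α * hg
      - b * f * τ.α * hDγ + f * b * derivHol V τ.α * hγ)

theorem Transformation.equivalent (τ : Transformation V W) (Φ : Coeff V →ₗ[ℂ] Coeff W)
    (h : ∀ x, τ.funEquiv.conj (evenMap V x) = evenMap W (Φ x)) (M : Submodule ℂ (Coeff V)) :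
    Equivalent (M.map (evenMap V)) ((M.map Φ).map (evenMap W)) := by
  refine ⟨τ, ?_⟩
  rw [← Submodule.map_comp, ← Submodule.map_comp]
  congr 1
  exact LinearMap.ext fun x => (h x).symm

/-- The pullback of units along a transformation. -/
def Transformation.pullUnits (τ : Transformation V W) (u : (Hol W)ˣ) : (Hol V)ˣ where
  val := τ.pull u
  inv := τ.pull (u⁻¹ : (Hol W)ˣ)
  val_inv := by rw [← τ.pull_mul, Units.mul_inv]; rfl
  inv_val := by rw [← τ.pull_mul, Units.inv_mul]; rfl

/-- Composition of transformations. -/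
def Transformation.trans (τ : Transformation V W) (υ : Transformation W X) :
    Transformation V X where
  φ := τ.φ.trans υ.φ
  analytic_φ := (compHol τ.φ τ.analytic_φ υ.newCoord).2
  analytic_symm := (compHol υ.φ.symm υ.analytic_symm ⟨_, τ.analytic_symm⟩).2
  α := τ.α * τ.pullUnits υ.α
  β := τ.β * τ.pullUnits υ.β

theorem Transformation.funEquiv_trans (τ : Transformation V W) (υ : Transformation W X) :
    (τ.trans υ).funEquiv = τ.funEquiv.trans υ.funEquiv := by
  refine LinearEquiv.ext fun p => Prod.ext (Hol.ext fun x => ?_) (Hol.ext fun x => ?_)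
  · change (τ.α * τ.pullUnits υ.α : Hol V) (τ.φ.symm (υ.φ.symm x)) * _ =
      (υ.α : Hol W) (υ.φ.symm x) * ((τ.α : Hol V) (τ.φ.symm (υ.φ.symm x)) * _)
    rw [Hol.mul_apply, show (τ.pullUnits υ.α : Hol V) (τ.φ.symm (υ.φ.symm x)) =
      (υ.α : Hol W) (υ.φ.symm x) from congrArg _ (τ.φ.apply_symm_apply _)]
    change _ * p.1 (τ.φ.symm (υ.φ.symm x)) = _ * (_ * p.1 (τ.φ.symm (υ.φ.symm x)))
    ring
  · have e : τ.α * τ.pullUnits υ.α * (τ.β * τ.pullUnits υ.β)⁻¹ =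
        (τ.α * τ.β⁻¹) * τ.pullUnits (υ.α * υ.β⁻¹) := by
      rw [show τ.pullUnits (υ.α * υ.β⁻¹) = τ.pullUnits υ.α * (τ.pullUnits υ.β)⁻¹ from
        Units.ext rfl, mul_inv]
      exact mul_mul_mul_comm _ _ _ _
    change ((τ.α * τ.pullUnits υ.α * (τ.β * τ.pullUnits υ.β)⁻¹ : (Hol V)ˣ) : Hol V)
      (τ.φ.symm (υ.φ.symm x)) * p.2 (τ.φ.symm (υ.φ.symm x)) =
      ((υ.α * υ.β⁻¹ : (Hol W)ˣ) : Hol W) (υ.φ.symm x) *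
        (((τ.α * τ.β⁻¹ : (Hol V)ˣ) : Hol V) (τ.φ.symm (υ.φ.symm x)) *
          p.2 (τ.φ.symm (υ.φ.symm x)))
    rw [e, Units.val_mul, Hol.mul_apply,
      show (τ.pullUnits (υ.α * υ.β⁻¹) : Hol V) (τ.φ.symm (υ.φ.symm x)) =
      ((υ.α * υ.β⁻¹ : (Hol W)ˣ) : Hol W) (υ.φ.symm x) from
        congrArg (fun w => ((υ.α * υ.β⁻¹ : (Hol W)ˣ) : Hol W) w) (τ.φ.apply_symm_apply _)]
    ring

theorem Equivalent.trans {L : Submodule ℂ (Op V)} {L' : Submodule ℂ (Op W)}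
    {L'' : Submodule ℂ (Op X)} (h : Equivalent L L') (h' : Equivalent L' L'') :
    Equivalent L L'' := by
  obtain ⟨τ, rfl⟩ := h
  obtain ⟨υ, rfl⟩ := h'
  refine ⟨τ.trans υ, ?_⟩
  rw [← Submodule.map_comp, τ.funEquiv_trans υ]
  rfl

/-- A transformation that only changes the gauge and the scale of `θ`. -/
def Transformation.ofUnits (α β : (Hol V)ˣ) : Transformation V V where
  φ := Equiv.refl V
  analytic_φ := (coord V).2
  analytic_symm := (coord V).2
  α := α
  β := β

theorem Equivalent.refl (L : Submodule ℂ (Op V)) : Equivalent L L := by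
  refine ⟨Transformation.ofUnits 1 1, ?_⟩
  have : (Transformation.ofUnits (1 : (Hol V)ˣ) 1).funEquiv = LinearEquiv.refl ℂ _ := by
    refine LinearEquiv.ext fun p => Prod.ext (Hol.ext fun x => ?_) (Hol.ext fun x => ?_)
    · exact one_mul (p.1 x)
    · change (((1 : (Hol V)ˣ) * 1⁻¹ : (Hol V)ˣ) : Hol V) x * p.2 x = p.2 x
      rw [inv_one, mul_one]
      exact one_mul (p.2 x)
  rw [this]
  exact (Submodule.map_id L).symm

/-- The action on coefficients of a gauge transformation and a rescaling of `θ` whose logarithmic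
derivatives are `-p` and `q`. -/
def gauge (q p : Hol V) : Coeff V →ₗ[ℂ] Coeff V where
  toFun x := (x.1, x.2.1 + x.1 * q, x.2.2 + x.1 * p)
  map_add' x y := by
    ext1
    · rfl
    · ext1 <;> simp only [Prod.fst_add, Prod.snd_add] <;> ring
  map_smul' c x := by simp

theorem gauge_apply (q p f g h : Hol V) : gauge q p (f, g, h) = (f, g + f * q, h + f * p) := rfl

theorem bracket_gauge (q p : Hol V) (x y : Coeff V) :
    bracket (gauge q p x) (gauge q p y) = gauge q p (bracket x y) := by
  obtain ⟨f, g, h⟩ := x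
  obtain ⟨f', g', h'⟩ := y
  simp only [gauge_apply, bracket, map_add, derivHol_mul]
  ext1
  · rfl
  · ext1 <;> simp only <;> ring

/-- On a disc `q` and `p` have primitives `Q` and `P`; the gauge factor `exp (-P)` and the scale
`exp Q` realise the shifts by `f p` and `f q`. -/
theorem equivalent_map_gauge {c : ℂ} {r : ℝ} (hV : (V : Set ℂ) = Metric.ball c r) (q p : Hol V)
    (M : Submodule ℂ (Coeff V)) :
    Equivalent (M.map (evenMap V)) ((M.map (gauge q p)).map (evenMap V)) := by
  obtain ⟨Q, rfl⟩ := Hol.exists_derivHol_eq_of_ball hV q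
  obtain ⟨P, rfl⟩ := Hol.exists_derivHol_eq_of_ball hV p
  obtain ⟨u, hu⟩ := (-P).exists_unit_cexp
  obtain ⟨v, hv⟩ := Q.exists_unit_cexp
  refine (Transformation.ofUnits u v).equivalent _ ?_ M
  rintro ⟨f, g, h⟩
  refine Transformation.conj_evenOp _ ?_ ?_ ?_
  · change f = f * derivHol V (coord V)
    rw [derivHol_coord, mul_one]
  · change (g + f * derivHol V Q) * v = g * v + f * derivHol V v
    rw [hv, Q.derivHol_cexp]
    ring
  · change (h + f * derivHol V P) * u = h * u - f * derivHol V u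
    rw [hu, Hol.derivHol_cexp, map_neg]
    ring

end Transformation

/-! ### Rectification of a vector field -/

section Rectify

variable {U V W : Opens ℂ}

/-- A non-vanishing vector field becomes `∂_z` in a suitable local coordinate, which maps a
neighbourhood onto a disc. -/
theorem exists_rectifying_transformation (f : Hol U) (z₀ : U) (h0 : f z₀ ≠ 0) :
    ∃ (V : Opens ℂ) (hVU : V ≤ U) (hz : (z₀ : ℂ) ∈ V) (W : Opens ℂ) (r : ℝ)
      (τ : Transformation V W), 0 < r ∧ (W : Set ℂ) = Metric.ball 0 r ∧ τ.α = 1 ∧ τ.β = 1 ∧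
        (τ.φ ⟨z₀, hz⟩ : ℂ) = 0 ∧ resHol hVU f * derivHol V τ.newCoord = 1 := by
  set F := extendZero ⇑f with hF
  have hFa : AnalyticOnNhd ℂ F U := analyticOnNhd_extendZero f
  have hF0 : F z₀ ≠ 0 := by rwa [hF, extendZero_apply]
  have hev : ∀ᶠ z in nhds (z₀ : ℂ), z ∈ U ∧ F z ≠ 0 :=
    (U.isOpen.eventually_mem z₀.2).and
      ((hFa z₀ z₀.2).continuousAt.eventually_ne hF0)
  obtain ⟨ρ, hρ, hball⟩ := Metric.eventually_nhds_iff_ball.1 hev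
  have hinv : DifferentiableOn ℂ (fun z => (F z)⁻¹) (Metric.ball (z₀ : ℂ) ρ) := fun z hz =>
    ((hFa z (hball z hz).1).differentiableAt.inv (hball z hz).2).differentiableWithinAt
  -- The straightening coordinate is the primitive of `1/f` that vanishes at `z₀`.
  obtain ⟨Ψ, hΨ0, hΨ⟩ := hinv.isExactOn_ball.with_val_at (z₀ : ℂ) 0
  have hz₀ρ : (z₀ : ℂ) ∈ Metric.ball (z₀ : ℂ) ρ := Metric.mem_ball_self hρ
  have hΨa : AnalyticOnNhd ℂ Ψ (Metric.ball (z₀ : ℂ) ρ) :=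
    DifferentiableOn.analyticOnNhd
      (fun z hz => (hΨ z hz).differentiableAt.differentiableWithinAt) Metric.isOpen_ball
  have hstrict : HasStrictDerivAt Ψ (F z₀)⁻¹ z₀ := by
    have := (hΨa z₀ hz₀ρ).hasStrictDerivAt
    rwa [(hΨ z₀ hz₀ρ).deriv] at this
  set e := (hstrict.hasStrictFDerivAt_equiv (inv_ne_zero hF0)).toOpenPartialHomeomorph Ψ
  have he : ∀ z, e z = Ψ z := fun _ => rfl
  have hze : (z₀ : ℂ) ∈ e.source :=
    (hstrict.hasStrictFDerivAt_equiv (inv_ne_zero hF0)).mem_toOpenPartialHomeomorph_source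
  set e' := e.restrOpen (Metric.ball (z₀ : ℂ) ρ) Metric.isOpen_ball
  have he' : ∀ z, e' z = Ψ z := fun _ => rfl
  have hze' : (z₀ : ℂ) ∈ e'.source := ⟨hze, hz₀ρ⟩
  have hsub : ∀ z ∈ e'.source, z ∈ Metric.ball (z₀ : ℂ) ρ := fun z hz => hz.2
  have h0t : (0 : ℂ) ∈ e'.target := by
    have := e'.map_source hze'
    rwa [he', hΨ0] at this
  -- The neighbourhood is taken to be the preimage of a disc, since later gauge transformations need
  -- primitives on the image.
  obtain ⟨r, hr, hrt⟩ := Metric.isOpen_iff.1 e'.open_target 0 h0t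
  let V : Opens ℂ := ⟨e'.source ∩ e' ⁻¹' Metric.ball 0 r,
    e'.isOpen_inter_preimage Metric.isOpen_ball⟩
  let W : Opens ℂ := ⟨Metric.ball 0 r, Metric.isOpen_ball⟩
  have hVU : V ≤ U := fun z hz => (hball z (hsub z hz.1)).1
  have hz : (z₀ : ℂ) ∈ V := ⟨hze', by
    change e' z₀ ∈ Metric.ball 0 r
    rw [he', hΨ0]
    exact Metric.mem_ball_self hr⟩
  let φ : V ≃ W :=
    { toFun := fun z => ⟨e' z, z.2.2⟩
      invFun := fun w => ⟨e'.symm w, e'.map_target (hrt w.2), by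
        change e' (e'.symm w) ∈ Metric.ball 0 r
        rw [e'.right_inv (hrt w.2)]
        exact w.2⟩
      left_inv := fun z => Subtype.ext (e'.left_inv z.2.1)
      right_inv := fun w => Subtype.ext (e'.right_inv (hrt w.2)) }
  have hφ : (fun z => (φ z : ℂ)) ∈ holSubalgebra V :=
    ⟨Ψ, hΨa.mono fun z hz => hsub z hz.1, fun _ => rfl⟩
  have hφs : (fun w => (φ.symm w : ℂ)) ∈ holSubalgebra W := by
    refine ⟨e'.symm, DifferentiableOn.analyticOnNhd (fun w hw => ?_) W.isOpen, fun _ => rfl⟩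
    have hs := hsub _ (e'.map_target (hrt hw))
    exact (e'.hasDerivAt_symm (hrt hw) (inv_ne_zero (hball _ hs).2)
      (hΨ _ hs)).differentiableAt.differentiableWithinAt
  refine ⟨V, hVU, hz, W, r, ⟨φ, hφ, hφs, 1, 1⟩, hr, rfl, rfl, rfl, hΨ0, Hol.ext fun z => ?_⟩
  have hs := hsub z z.2.1
  rw [Hol.mul_apply, Hol.one_apply, derivHol_apply_of_hasDerivAt (F := Ψ) (fun _ => rfl) (hΨ z hs)]
  rw [show resHol hVU f z = F z from (extendZero_apply ⇑f ⟨z, hVU z.2⟩).symm]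
  exact mul_inv_cancel₀ (hball _ hs).2

/-- The action on coefficients of the change of the even coordinate. -/
def Transformation.pushCoeff (τ : Transformation V W) : Coeff V →ₗ[ℂ] Coeff W :=
  (τ.compEquiv.toLinearMap ∘ₗ LinearMap.mulRight ℂ (derivHol V τ.newCoord)).prodMap
    (τ.compEquiv.toLinearMap.prodMap τ.compEquiv.toLinearMap)

theorem Transformation.conj_evenMap (τ : Transformation V W) (hα : τ.α = 1) (hβ : τ.β = 1)
    (x : Coeff V) : τ.funEquiv.conj (evenMap V x) = evenMap W (τ.pushCoeff x) := by
  obtain ⟨f, g, h⟩ := x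
  refine τ.conj_evenOp ?_ ?_ ?_
  · exact τ.pull_compEquiv _
  · rw [hβ, Units.val_one, derivHol_one, mul_one, mul_one, mul_zero, add_zero]
    exact τ.pull_compEquiv _
  · rw [hα, Units.val_one, derivHol_one, mul_one, mul_one, mul_zero, sub_zero]
    exact τ.pull_compEquiv _

/-- Conjugation is multiplicative, so it preserves commutators; injectivity of `evenMap` transfers
this to coefficients. -/
theorem Transformation.bracket_pushCoeff (τ : Transformation V W) (hα : τ.α = 1) (hβ : τ.β = 1)
    (x y : Coeff V) :
    bracket (τ.pushCoeff x) (τ.pushCoeff y) = τ.pushCoeff (bracket x y) := by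
  apply evenMap_injective
  have hmul : ∀ A B : Op V, τ.funEquiv.conj (A * B) = τ.funEquiv.conj A * τ.funEquiv.conj B :=
    fun A B => τ.funEquiv.conj_comp B A
  rw [evenMap_bracket, ← τ.conj_evenMap hα hβ, ← τ.conj_evenMap hα hβ, ← τ.conj_evenMap hα hβ,
    evenMap_bracket, map_sub, hmul, hmul]

/-- Finite-dimensional bracket-closed spaces of coefficients in which the coefficient of `θ∂_θ` in
every operator without `∂_z` term is constant. -/
structure IsAdmissible (M : Submodule ℂ (Coeff U)) : Prop where
  finiteDimensional : FiniteDimensional ℂ M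
  closed : IsBracketClosed M
  const : ∀ g h, ((0, g, h) : Coeff U) ∈ M → ∃ c : ℂ, g = c • (1 : Hol U)

theorem IsAdmissible.map_gauge {M : Submodule ℂ (Coeff U)} (hM : IsAdmissible M) (q p : Hol U) :
    IsAdmissible (M.map (gauge q p)) where
  finiteDimensional := by
    have := hM.finiteDimensional
    infer_instance
  closed := by
    rintro _ ⟨x, hx, rfl⟩ _ ⟨y, hy, rfl⟩
    exact ⟨bracket x y, hM.closed x hx y hy, (bracket_gauge q p x y).symm⟩
  const := by
    rintro g h ⟨⟨f', g', h'⟩, hx, e⟩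
    rw [gauge_apply, Prod.mk.injEq, Prod.mk.injEq] at e
    obtain ⟨rfl, rfl, rfl⟩ := e
    rw [zero_mul, add_zero]
    exact hM.const g' h' hx

/-- Straightening `x₀.1` to `∂_z` turns the dichotomy for vector fields into a concrete one: only
constant multiples of `∂_z` occur, or `z ∂_z` occurs too. -/
theorem IsAdmissible.rectify (hU : IsConnected (U : Set ℂ)) {M : Submodule ℂ (Coeff U)}
    (hM : IsAdmissible M) (z₀ : U) {x₀ : Coeff U} (hx₀ : x₀ ∈ M) (h0 : x₀.1 z₀ ≠ 0)
    (hdich : (∀ x ∈ M, ∃ c : ℂ, x.1 = c • x₀.1) ∨ ∃ x₁ ∈ M, x₁.1 z₀ = 0 ∧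
      x₁.1 * derivHol U x₀.1 - x₀.1 * derivHol U x₁.1 = -x₀.1) :
    ∃ (V : Opens ℂ) (hVU : V ≤ U), (z₀ : ℂ) ∈ V ∧ ∃ (W : Opens ℂ) (r : ℝ)
      (N : Submodule ℂ (Coeff W)), 0 < r ∧ (W : Set ℂ) = Metric.ball 0 r ∧ IsAdmissible N ∧
        Equivalent (restrictOps hVU (M.map (evenMap U))) (N.map (evenMap W)) ∧
        (∃ g h, (1, g, h) ∈ N) ∧
        ((∀ x ∈ N, ∃ c : ℂ, x.1 = c • (1 : Hol W)) ∨ ∃ g h, (coord W, g, h) ∈ N) := by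
  obtain ⟨V, hVU, hz, W, r, τ, hr, hW, hα, hβ, hφ0, hrect⟩ :=
    exists_rectifying_transformation x₀.1 z₀ h0
  have := hM.finiteDimensional
  have hone : τ.compEquiv 1 = 1 := rfl
  have h1 : (τ.pushCoeff (resCoeff hVU x₀)).1 = 1 := by
    change τ.compEquiv (resHol hVU x₀.1 * derivHol V τ.newCoord) = 1
    rw [hrect, hone]
  have hWc : IsPreconnected (W : Set ℂ) := hW ▸ (convex_ball (0 : ℂ) r).isPreconnected
  have hclosed : IsBracketClosed ((M.map (resCoeff hVU)).map τ.pushCoeff) := by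
    rintro _ ⟨_, ⟨x, hx, rfl⟩, rfl⟩ _ ⟨_, ⟨y, hy, rfl⟩, rfl⟩
    rw [τ.bracket_pushCoeff hα hβ, ← resCoeff_bracket]
    exact ⟨_, ⟨_, hM.closed x hx y hy, rfl⟩, rfl⟩
  refine ⟨V, hVU, hz, W, r, (M.map (resCoeff hVU)).map τ.pushCoeff, hr, hW,
    ⟨inferInstance, hclosed, ?_⟩, ?_, ?_, ?_⟩
  · rintro g h ⟨_, ⟨⟨f, g', h'⟩, hx, rfl⟩, e⟩
    change (τ.compEquiv (resHol hVU f * derivHol V τ.newCoord), τ.compEquiv (resHol hVU g'),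
      τ.compEquiv (resHol hVU h')) = _ at e
    rw [Prod.mk.injEq, Prod.mk.injEq] at e
    obtain ⟨ef, rfl, -⟩ := e
    have hf0 : resHol hVU f = 0 := by
      have : resHol hVU f * derivHol V τ.newCoord = 0 := by simpa using ef
      linear_combination resHol hVU x₀.1 * this - resHol hVU f * hrect
    obtain rfl : f = 0 := resHol_eq_zero hU.isPreconnected hVU ⟨z₀, hz⟩ hf0
    obtain ⟨c, rfl⟩ := hM.const g' h' hx
    exact ⟨c, rfl⟩
  · rw [restrictOps_map_evenMap]
    exact τ.equivalent _ (τ.conj_evenMap hα hβ) _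
  · refine ⟨(τ.pushCoeff (resCoeff hVU x₀)).2.1, (τ.pushCoeff (resCoeff hVU x₀)).2.2, _,
      ⟨x₀, hx₀, rfl⟩, ?_⟩
    rw [← h1]
  · refine hdich.imp ?_ ?_
    · rintro hc _ ⟨_, ⟨x, hx, rfl⟩, rfl⟩
      obtain ⟨c, e⟩ := hc x hx
      refine ⟨c, ?_⟩
      rw [← h1]
      change τ.compEquiv (resHol hVU x.1 * derivHol V τ.newCoord) =
        c • τ.compEquiv (resHol hVU x₀.1 * derivHol V τ.newCoord)
      rw [e, map_smul, smul_mul_assoc, map_smul]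
    · rintro ⟨x₁, hx₁, hz₁, hw⟩
      set y₀ := τ.pushCoeff (resCoeff hVU x₀) with hy₀
      set y₁ := τ.pushCoeff (resCoeff hVU x₁) with hy₁
      have hb : (bracket y₁ y₀).1 = -y₀.1 := by
        rw [hy₀, hy₁, τ.bracket_pushCoeff hα hβ, ← resCoeff_bracket]
        change τ.compEquiv (resHol hVU (x₁.1 * derivHol U x₀.1 - x₀.1 * derivHol U x₁.1) *
          derivHol V τ.newCoord) = -τ.compEquiv (resHol hVU x₀.1 * derivHol V τ.newCoord)
        rw [hw, map_neg, neg_mul, map_neg]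
      -- With `y₀.1 = 1` the relation `[y₁, y₀] = -y₀` says `y₁.1' = 1`, so `y₁.1 = z + c`; then `c
      -- = 0` because `z₀` is sent to the origin and `x₁.1` vanishes at `z₀`.
      have hd : derivHol W (y₁.1 - coord W) = 0 := by
        change y₁.1 * derivHol W y₀.1 - y₀.1 * derivHol W y₁.1 = -y₀.1 at hb
        rw [h1, derivHol_one] at hb
        rw [map_sub, derivHol_coord]
        linear_combination -hb
      obtain ⟨c, hc⟩ := Hol.exists_eq_smul_one_of_derivHol_eq_zero hWc hd
      have hc0 : c = 0 := by
        have e1 := congrArg (fun k : Hol W => k (τ.φ ⟨z₀, hz⟩)) hc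
        simp only [Hol.sub_apply, Hol.smul_apply, Hol.one_apply, coord_apply, hφ0, mul_one,
          sub_zero] at e1
        rw [← e1]
        change resHol hVU x₁.1 (τ.φ.symm (τ.φ ⟨z₀, hz⟩)) *
          derivHol V τ.newCoord (τ.φ.symm (τ.φ ⟨z₀, hz⟩)) = 0
        rw [Equiv.symm_apply_apply]
        change x₁.1 z₀ * _ = 0
        rw [hz₁, zero_mul]
      rw [hc0, zero_smul, sub_eq_zero] at hc
      refine ⟨y₁.2.1, y₁.2.2, _, ⟨x₁, hx₁, rfl⟩, ?_⟩
      rw [← hc]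

end Rectify

/-! ### Vector fields near a point where one of them does not vanish -/

section VectorFields

variable {U : Opens ℂ}

/-- The order of vanishing of an analytic function at a point. -/
def Hol.order (f : Hol U) (x : U) : ℕ∞ := analyticOrderAt (extendZero ⇑f) x

theorem Hol.analyticAt_extendZero (f : Hol U) (x : U) : AnalyticAt ℂ (extendZero ⇑f) x :=
  analyticOnNhd_extendZero f x x.2

theorem Hol.order_eq_zero {f : Hol U} {x : U} : f.order x = 0 ↔ f x ≠ 0 := by
  rw [Hol.order, (f.analyticAt_extendZero x).analyticOrderAt_eq_zero, extendZero_apply]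

theorem Hol.order_mul (f g : Hol U) (x : U) : (f * g).order x = f.order x + g.order x := by
  rw [Hol.order, analyticOrderAt_congr (extendZero_eventuallyEq (f * g)
    (F := extendZero ⇑f * extendZero ⇑g) (fun y => ?_) x)]
  · exact analyticOrderAt_mul (f.analyticAt_extendZero x) (g.analyticAt_extendZero x)
  · rw [Pi.mul_apply, extendZero_apply, extendZero_apply]
    rfl

theorem Hol.le_order_add (f g : Hol U) (x : U) :
    min (f.order x) (g.order x) ≤ (f + g).order x := by
  refine le_analyticOrderAt_add.trans_eq ?_
  rw [Hol.order, show ⇑(f + g) = ⇑f + ⇑g from rfl, extendZero_add]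

theorem Hol.order_derivHol_add_one {f : Hol U} {x : U} (h : f x = 0) :
    (derivHol U f).order x + 1 = f.order x := by
  rw [Hol.order, analyticOrderAt_congr (extendZero_eventuallyEq (derivHol U f)
      (F := deriv (extendZero ⇑f)) (fun _ => rfl) x),
    (f.analyticAt_extendZero x).analyticOrderAt_deriv_add_one, extendZero_apply, h]
  simp [Hol.order]

theorem Hol.eq_zero_of_order_eq_top (hU : IsPreconnected (U : Set ℂ)) {f : Hol U} {x : U}
    (h : f.order x = ⊤) : f = 0 :=
  Hol.eq_zero_of_eventually hU x (analyticOrderAt_eq_top.1 h)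

/-- A finite-dimensional space of functions stable under multiplication by `g` forces `g` to be
constant. -/
theorem Hol.exists_eq_smul_one_of_mul_mem (hU : IsPreconnected (U : Set ℂ))
    (P : Submodule ℂ (Hol U)) [FiniteDimensional ℂ P] (hP : P ≠ ⊥) {g : Hol U}
    (h : ∀ k ∈ P, g * k ∈ P) : ∃ c : ℂ, g = c • (1 : Hol U) := by
  have : Nontrivial P := Submodule.nontrivial_iff_ne_bot.2 hP
  -- An eigenvector `k` of multiplication by `g` satisfies `(g - c) k = 0`, and analytic functions
  -- on a domain have no zero divisors.
  obtain ⟨c, hc⟩ := Module.End.exists_eigenvalue ((LinearMap.mulLeft ℂ g).restrict h)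
  obtain ⟨k, hk⟩ := hc.exists_hasEigenvector
  have e : g * (k : Hol U) = c • (k : Hol U) := congrArg Subtype.val hk.apply_eq_smul
  have e' : (g - c • (1 : Hol U)) * (k : Hol U) = 0 := by
    rw [sub_mul, e, smul_mul_assoc, one_mul, sub_self]
  rcases Hol.eq_zero_or_eq_zero_of_mul hU e' with h0 | h0
  · exact ⟨c, sub_eq_zero.1 h0⟩
  · exact absurd (Subtype.ext h0) hk.2

/-- In a finite-dimensional Lie algebra of vector fields on a domain that does not vanish at `z₀`,
either all vector fields are proportional, or there are vector fields `f₀` and `f₁` with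
`f₀(z₀) ≠ 0`, `f₁(z₀) = 0` and `[f₁, f₀] = -f₀`. -/
theorem exists_affine_pair (hU : IsPreconnected (U : Set ℂ)) (F : Submodule ℂ (Hol U))
    [FiniteDimensional ℂ F]
    (hF : ∀ f ∈ F, ∀ g ∈ F, f * derivHol U g - g * derivHol U f ∈ F) (z₀ : U)
    (hz₀ : ∃ p ∈ F, p z₀ ≠ 0) :
    ∃ f₀ ∈ F, f₀ z₀ ≠ 0 ∧ ((∀ f ∈ F, ∃ c : ℂ, f = c • f₀) ∨
      ∃ f₁ ∈ F, f₁ z₀ = 0 ∧ f₁ * derivHol U f₀ - f₀ * derivHol U f₁ = -f₀) := by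
  obtain ⟨p, hp, hpz⟩ := hz₀
  by_cases hK : ∀ f ∈ F, f z₀ = 0 → f = 0
  · refine ⟨p, hp, hpz, Or.inl fun f hf => ⟨f z₀ / p z₀, ?_⟩⟩
    rw [← sub_eq_zero]
    refine hK _ (F.sub_mem hf (F.smul_mem _ hp)) ?_
    rw [Hol.sub_apply, Hol.smul_apply, div_mul_cancel₀ _ hpz, sub_self]
  push Not at hK
  obtain ⟨k, hk, hkz, hk0⟩ := hK
  -- Otherwise every field of `F` vanishing at `z₀` vanishes there to order at least 2. Then `p f' -
  -- f p'` is again such a field, and since `p z₀ ≠ 0` a lower bound `n` on all orders improves to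
  -- `n + 1`; all these fields would be zero.
  obtain ⟨f₂, hf₂, hf₂z, hf₂d⟩ : ∃ f ∈ F, f z₀ = 0 ∧ derivHol U f z₀ ≠ 0 := by
    by_contra! hcon
    have key : ∀ n : ℕ, ∀ f ∈ F, f z₀ = 0 → (n : ℕ∞) ≤ f.order z₀ := by
      intro n
      induction n with
      | zero => intro f _ _; exact zero_le
      | succ n ih =>
        intro f hf hfz
        have hB := ih _ (hF p hp f hf) (by
          rw [Hol.sub_apply, Hol.mul_apply, Hol.mul_apply, hcon f hf hfz, hfz]
          simp)
        have hA : (n : ℕ∞) ≤ (f * derivHol U p).order z₀ := by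
          rw [Hol.order_mul]
          exact (ih f hf hfz).trans le_self_add
        have hC := (le_min hB hA).trans (Hol.le_order_add _ _ z₀)
        rw [sub_add_cancel, Hol.order_mul, Hol.order_eq_zero.2 hpz, zero_add] at hC
        rw [← Hol.order_derivHol_add_one hfz]
        push_cast
        gcongr
    refine hk0 (Hol.eq_zero_of_order_eq_top hU (x := z₀) ?_)
    exact ENat.eq_top_iff_forall_ge.2 fun n => key n k hk hkz
  set f₁ := (derivHol U f₂ z₀)⁻¹ • f₂ with hf₁
  have hf₁F : f₁ ∈ F := F.smul_mem _ hf₂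
  have hf₁z : f₁ z₀ = 0 := by rw [hf₁, Hol.smul_apply, hf₂z, mul_zero]
  have hf₁d : derivHol U f₁ z₀ = 1 := by
    rw [hf₁, map_smul, Hol.smul_apply, inv_mul_cancel₀ hf₂d]
  -- `T` is `ad f₁ + 1`. Because `f₁` vanishes at `z₀` with derivative 1, every `T f` vanishes at
  -- `z₀`; so `T` misses `p`, is not injective, and its kernel supplies `f₀`.
  let T : F →ₗ[ℂ] F :=
    (LinearMap.mulLeft ℂ f₁ ∘ₗ derivHol U - LinearMap.mulRight ℂ (derivHol U f₁) +
      LinearMap.id).restrict (p := F) (q := F) fun f hf => F.add_mem (hF f₁ hf₁F f hf) hf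
  have hT : ∀ f : F, (T f : Hol U) = f₁ * derivHol U f - f * derivHol U f₁ + f := fun _ => rfl
  have hTs : ¬ Function.Surjective T := fun hs => by
    obtain ⟨f, e⟩ := hs ⟨p, hp⟩
    refine hpz ?_
    have e' : (T f : Hol U) = p := congrArg Subtype.val e
    rw [← e', hT, Hol.add_apply, Hol.sub_apply, Hol.mul_apply, Hol.mul_apply, hf₁z, hf₁d]
    ring
  have hTi : ¬ Function.Injective T := fun hi => hTs (LinearMap.injective_iff_surjective.1 hi)
  rw [injective_iff_map_eq_zero] at hTi
  push Not at hTi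
  obtain ⟨⟨f₀, hf₀⟩, e, hne⟩ := hTi
  have hf₀0 : f₀ ≠ 0 := fun h => hne (Subtype.ext h)
  have e' : f₁ * derivHol U f₀ - f₀ * derivHol U f₁ + f₀ = 0 := by
    have := congrArg Subtype.val e
    exact this
  refine ⟨f₀, hf₀, fun hz => ?_, Or.inr ⟨f₁, hf₁F, hf₁z, eq_neg_of_add_eq_zero_left e'⟩⟩
  -- Were `f₀ z₀ = 0`, the left side would have the same order at `z₀` as `f₀`, while the right side
  -- has larger order since `f₁' - 1` vanishes at `z₀`.
  have e1 : f₁ * derivHol U f₀ = (derivHol U f₁ - 1) * f₀ := by linear_combination e'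
  have e2 := congrArg (fun k : Hol U => k.order z₀) e1
  simp only [Hol.order_mul] at e2
  have o1 : f₁.order z₀ = 1 := by
    rw [← Hol.order_derivHol_add_one hf₁z, Hol.order_eq_zero.2 (by rw [hf₁d]; exact one_ne_zero),
      zero_add]
  rw [o1, add_comm, Hol.order_derivHol_add_one hz] at e2
  have o2 : (derivHol U f₁ - 1).order z₀ ≠ 0 := fun h =>
    Hol.order_eq_zero.1 h (by rw [Hol.sub_apply, hf₁d, Hol.one_apply, sub_self])
  have o3 : f₀.order z₀ ≠ ⊤ := fun h => hf₀0 (Hol.eq_zero_of_order_eq_top hU h)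
  exact o2 (WithTop.add_right_cancel o3 ((zero_add _).trans e2)).symm

end VectorFields

/-! ### Spaces of functions stable under differentiation -/

section Stable

variable {U : Opens ℂ}

/-- Each `D ^ k` satisfies `[A, D ^ k] = -k D ^ k`. If none were zero, `ad A` would have infinitely
many eigenvalues on a finite-dimensional space. -/
theorem isNilpotent_of_commutator {E : Type*} [AddCommGroup E] [Module ℂ E]
    [FiniteDimensional ℂ E] {A D : Module.End ℂ E} (h : A * D - D * A = -D) : IsNilpotent D := by
  by_contra hn
  have hpow : ∀ k : ℕ, A * D ^ k - D ^ k * A = (-(k : ℂ)) • D ^ k := by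
    intro k
    induction k with
    | zero => simp
    | succ k ih =>
      rw [pow_succ, show A * (D ^ k * D) - D ^ k * D * A =
        (A * D ^ k - D ^ k * A) * D + D ^ k * (A * D - D * A) by noncomm_ring, ih, h]
      rw [smul_mul_assoc, mul_neg]
      push_cast
      module
  set T : Module.End ℂ (Module.End ℂ E) := LinearMap.mulLeft ℂ A - LinearMap.mulRight ℂ A
  have hev : ∀ k : ℕ, T.HasEigenvalue (-(k : ℂ)) := fun k =>
    Module.End.hasEigenvalue_of_hasEigenvector (x := D ^ k)
      ⟨Module.End.mem_eigenspace_iff.2 (hpow k), fun h0 => hn ⟨k, h0⟩⟩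
  refine Set.infinite_of_injective_forall_mem (f := fun k : ℕ => -(k : ℂ)) ?_ hev
    T.finite_hasEigenvalue
  intro a b hab
  exact_mod_cast neg_injective hab

/-- The space of polynomials in `z` of degree less than `n`. -/
def polySpace (U : Opens ℂ) (n : ℕ) : Submodule ℂ (Hol U) :=
  Submodule.span ℂ (Set.range fun l : Fin n => coord U ^ (l : ℕ))

theorem coord_pow_mem_polySpace {l n : ℕ} (h : l < n) : coord U ^ l ∈ polySpace U n :=
  Submodule.subset_span ⟨⟨l, h⟩, rfl⟩

theorem exists_derivHol_eq_of_mem_polySpace {n : ℕ} {k : Hol U} (hk : k ∈ polySpace U n) :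
    ∃ P ∈ polySpace U (n + 1), derivHol U P = k := by
  suffices polySpace U n ≤ (polySpace U (n + 1)).map (derivHol U) from this hk
  refine Submodule.span_le.2 ?_
  rintro _ ⟨l, rfl⟩
  refine ⟨((l : ℂ) + 1)⁻¹ • coord U ^ ((l : ℕ) + 1),
    Submodule.smul_mem _ _ (coord_pow_mem_polySpace (by omega)), ?_⟩
  rw [map_smul, derivHol_coord_pow, smul_smul]
  push_cast
  rw [inv_mul_cancel₀ (Nat.cast_add_one_ne_zero _), one_smul]

theorem mem_polySpace_iff (hU : IsPreconnected (U : Set ℂ)) {n : ℕ} {k : Hol U} :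
    k ∈ polySpace U n ↔ (derivHol U ^ n) k = 0 := by
  constructor
  · suffices polySpace U n ≤ LinearMap.ker (derivHol U ^ n) from fun h => this h
    refine Submodule.span_le.2 ?_
    rintro _ ⟨l, rfl⟩
    have : ∀ m l : ℕ, l < m → (derivHol U ^ m) (coord U ^ l) = 0 := by
      intro m
      induction m with
      | zero => intro l hl; omega
      | succ m ih =>
        intro l hl
        rw [pow_succ, Module.End.mul_apply, derivHol_coord_pow, map_smul]
        rcases Nat.eq_zero_or_pos l with rfl | hl'
        · simp
        · rw [ih (l - 1) (by omega), smul_zero]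
    exact this n l l.2
  · intro h
    induction n generalizing k with
    | zero =>
      obtain rfl : k = 0 := h
      exact zero_mem _
    | succ n ih =>
      rw [pow_succ, Module.End.mul_apply] at h
      obtain ⟨P, hP, e⟩ := exists_derivHol_eq_of_mem_polySpace (ih h)
      obtain ⟨c, hc⟩ := Hol.exists_eq_smul_one_of_derivHol_eq_zero hU (f := k - P)
        (by rw [map_sub, e, sub_self])
      rw [← sub_add_cancel k P, hc]
      refine add_mem (Submodule.smul_mem _ _ ?_) hP
      simpa using coord_pow_mem_polySpace (U := U) (Nat.succ_pos n)

/-- A finite-dimensional space of functions on which differentiation acts locally nilpotently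
consists of all polynomials up to a certain degree. -/
theorem eq_polySpace_of_nilpotent (hU : IsPreconnected (U : Set ℂ)) (P : Submodule ℂ (Hol U))
    [FiniteDimensional ℂ P] (hD : ∀ k ∈ P, derivHol U k ∈ P)
    (hnil : ∀ k ∈ P, ∃ m, (derivHol U ^ m) k = 0) : P = polySpace U (Module.finrank ℂ P) := by
  have : FiniteDimensional ℂ (polySpace U (Module.finrank ℂ P)) :=
    FiniteDimensional.span_of_finite ℂ (Set.finite_range _)
  refine Submodule.eq_of_le_of_finrank_le (fun k hk => ?_) ?_
  · rw [mem_polySpace_iff hU]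
    obtain ⟨m, hm⟩ := hnil k hk
    have hcoe : ∀ n (x : P), (((derivHol U).restrict hD ^ n) x : Hol U) = (derivHol U ^ n) x :=
      fun n x => by rw [Module.End.pow_restrict n]; rfl
    have h1 : (⟨k, hk⟩ : P) ∈ LinearMap.ker ((derivHol U).restrict hD ^ m) :=
      Subtype.ext ((hcoe m _).trans hm)
    -- The nilpotency order is at most the dimension `d` of `P`, so `P` lies in the polynomials of
    -- degree less than `d`; these have dimension at most `d`, which forces equality.
    have h2 := Module.End.ker_pow_le_ker_pow_finrank _ m h1
    rw [← hcoe _ ⟨k, hk⟩, LinearMap.mem_ker.1 h2]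
    rfl
  · refine (finrank_range_le_card _).trans_eq (Fintype.card_fin _)

/-- A finite-dimensional space of functions stable under `∂_z` and `z ∂_z` consists of all
polynomials up to a certain degree. -/
theorem eq_polySpace_of_euler (hU : IsPreconnected (U : Set ℂ)) (P : Submodule ℂ (Hol U))
    [FiniteDimensional ℂ P] (hD : ∀ k ∈ P, derivHol U k ∈ P)
    (hE : ∀ k ∈ P, coord U * derivHol U k ∈ P) : P = polySpace U (Module.finrank ℂ P) := by
  refine eq_polySpace_of_nilpotent hU P hD fun k hk => ?_
  let D : Module.End ℂ P := (derivHol U).restrict hD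
  let A : Module.End ℂ P := (LinearMap.mulLeft ℂ (coord U) ∘ₗ derivHol U).restrict hE
  have hAD : A * D - D * A = -D := by
    refine LinearMap.ext fun x => Subtype.ext ?_
    change coord U * derivHol U (derivHol U x) - derivHol U (coord U * derivHol U x) =
      -derivHol U x
    rw [derivHol_mul, derivHol_coord]
    ring
  obtain ⟨m, hm⟩ := isNilpotent_of_commutator hAD
  refine ⟨m, ?_⟩
  have := congrArg (fun T : Module.End ℂ P => (T ⟨k, hk⟩ : Hol U)) hm
  simp only [D, Module.End.pow_restrict m] at this
  exact this

/-- Multiplication by `exp (-σ z)` conjugates `d/dz - σ` into `d/dz`, which reduces generalized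
eigenspaces to the nilpotent case. -/
theorem derivHol_pow_expFun_mul (σ : ℂ) (m : ℕ) (k : Hol U) :
    (derivHol U ^ m) (expFun U (-σ) * k) =
      expFun U (-σ) * ((derivHol U - σ • (1 : Module.End ℂ (Hol U))) ^ m) k := by
  induction m generalizing k with
  | zero => rfl
  | succ m ih =>
    rw [pow_succ, pow_succ, Module.End.mul_apply, Module.End.mul_apply, ← ih, derivHol_mul,
      derivHol_expFun]
    congr 1
    rw [LinearMap.sub_apply, LinearMap.smul_apply, Module.End.one_apply, mul_sub,
      smul_mul_assoc, mul_smul_comm, neg_smul]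
    ring

/-- A finite-dimensional space of functions stable under differentiation is spanned by exponential
monomials. -/
theorem exists_eq_span_expMonomials (hU : IsPreconnected (U : Set ℂ)) (P : Submodule ℂ (Hol U))
    [FiniteDimensional ℂ P] (hD : ∀ k ∈ P, derivHol U k ∈ P) :
    ∃ (S : Finset ℂ) (s : ℂ → ℕ),
      P = Submodule.span ℂ {k | ∃ σ ∈ S, ∃ l ≤ s σ, k = coord U ^ l * expFun U σ} := by
  let T : Module.End ℂ P := (derivHol U).restrict hD
  let G : ℂ → Submodule ℂ (Hol U) := fun σ => (T.maxGenEigenspace σ).map P.subtype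
  have hPG : P = ⨆ σ, G σ := by
    rw [← Submodule.map_iSup, Module.End.iSup_maxGenEigenspace_eq_top, Submodule.map_subtype_top]
  have hcoe : ∀ (σ : ℂ) (m : ℕ) (x : P), (((T - σ • (1 : Module.End ℂ P)) ^ m) x : Hol U) =
      ((derivHol U - σ • (1 : Module.End ℂ (Hol U))) ^ m) x := by
    intro σ m
    induction m with
    | zero => intro x; rfl
    | succ m ih =>
      intro x
      rw [pow_succ, pow_succ, Module.End.mul_apply, Module.End.mul_apply, ih]
      rfl
  -- The equivalence with `G σ = ⊥` makes the set of `σ` with `n σ ≠ 0` finite, and on that set the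
  -- top exponent `n σ - 1` is not truncated.
  have hQ : ∀ σ, ∃ n : ℕ, (n = 0 ↔ G σ = ⊥) ∧
      G σ = Submodule.span ℂ (Set.range fun l : Fin n => coord U ^ (l : ℕ) * expFun U σ) := by
    intro σ
    let Q : Submodule ℂ (Hol U) := (G σ).map (LinearMap.mulLeft ℂ (expFun U (-σ)))
    have hGQ : G σ = Q.map (LinearMap.mulRight ℂ (expFun U σ)) := by
      rw [← Submodule.map_comp]
      have hid : LinearMap.mulRight ℂ (expFun U σ) ∘ₗ LinearMap.mulLeft ℂ (expFun U (-σ)) =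
          LinearMap.id := by
        refine LinearMap.ext fun k => ?_
        change expFun U (-σ) * k * expFun U σ = k
        linear_combination k * expFun_mul_expFun_neg (U := U) σ
      rw [hid, Submodule.map_id]
    have hnil : ∀ k ∈ Q, ∃ m, (derivHol U ^ m) k = 0 := by
      rintro _ ⟨_, ⟨x, hx, rfl⟩, rfl⟩
      obtain ⟨m, hm⟩ := (Module.End.mem_maxGenEigenspace _ _ _).1 hx
      refine ⟨m, ?_⟩
      refine (derivHol_pow_expFun_mul σ m _).trans ?_
      rw [P.subtype_apply, ← hcoe, hm]
      exact mul_zero _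
    have hstab : ∀ k ∈ Q, derivHol U k ∈ Q := by
      rintro _ ⟨_, ⟨x, hx, rfl⟩, rfl⟩
      have hT : T x - σ • x ∈ T.maxGenEigenspace σ :=
        Submodule.sub_mem _
          (Module.End.mapsTo_maxGenEigenspace_of_comm (Commute.refl T) σ hx)
          (Submodule.smul_mem _ _ hx)
      refine ⟨_, ⟨_, hT, rfl⟩, ?_⟩
      have := derivHol_pow_expFun_mul σ 1 (x : Hol U)
      rw [pow_one, pow_one] at this
      exact this.symm
    have hfin : FiniteDimensional ℂ (G σ) := inferInstance
    have hQf : FiniteDimensional ℂ Q := inferInstance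
    have hpoly := eq_polySpace_of_nilpotent hU Q hstab hnil
    refine ⟨Module.finrank ℂ Q, ?_, ?_⟩
    · rw [Submodule.finrank_eq_zero]
      constructor
      · intro h
        rw [hGQ, h, Submodule.map_bot]
      · intro h
        change (G σ).map _ = ⊥
        rw [h, Submodule.map_bot]
    · conv_lhs => rw [hGQ, hpoly, polySpace, Submodule.map_span, ← Set.range_comp]
      rfl
  choose n hn0 hn using hQ
  have hfinite : Set.Finite {σ | n σ ≠ 0} := by
    refine T.finite_hasEigenvalue.subset fun σ hσ => ?_
    have : T.HasUnifEigenvalue σ ⊤ := fun h => by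
      refine hσ ((hn0 σ).2 ?_)
      change (T.maxGenEigenspace σ).map _ = ⊥
      rw [show T.maxGenEigenspace σ = ⊥ from h, Submodule.map_bot]
    exact this.lt zero_lt_one
  refine ⟨hfinite.toFinset, fun σ => n σ - 1, ?_⟩
  conv_lhs => rw [hPG]
  apply le_antisymm
  · refine iSup_le fun σ => ?_
    rw [hn σ]
    refine Submodule.span_le.2 ?_
    rintro _ ⟨l, rfl⟩
    refine Submodule.subset_span ⟨σ, ?_, l, Nat.le_pred_of_lt l.2, rfl⟩
    rw [Set.Finite.mem_toFinset]
    exact fun h : n σ = 0 => absurd l.2 (by omega)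
  · refine Submodule.span_le.2 ?_
    rintro _ ⟨σ, hσ, l, hl, rfl⟩
    rw [Set.Finite.mem_toFinset, Set.mem_ofPred_eq] at hσ
    change l ≤ n σ - 1 at hl
    refine Submodule.mem_iSup_of_mem σ ?_
    rw [hn σ]
    exact Submodule.subset_span ⟨⟨l, by omega⟩, rfl⟩

end Stable

/-! ### Normal forms -/

section NormalForms

variable {W : Opens ℂ}

theorem evenMap_zero_zero (h : Hol W) : evenMap W (0, 0, h) = mulOp h := by
  change evenOp 0 0 h = _
  simp [evenOp, mulOp_zero]

theorem mulOp_one : mulOp (1 : Hol W) = 1 :=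
  LinearMap.ext fun p => by rw [mulOp_apply, one_mul, one_mul]; rfl

theorem evenMap_one : evenMap W (1, 0, 0) = dz W := by
  change evenOp 1 0 0 = _
  simp [evenOp, mulOp_zero, mulOp_one]

theorem evenMap_smul_one (f : Hol W) (c : ℂ) (h : Hol W) :
    evenMap W (f, c • 1, h) = mulOp f * dz W + c • (theta W * dtheta W) + mulOp h := by
  change evenOp _ _ _ = _
  simp [evenOp, mulOp_smul, mulOp_one]

theorem evenMap_zero_smul_one (c : ℂ) (h : Hol W) :
    evenMap W (0, c • 1, h) = c • (theta W * dtheta W) + mulOp h := by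
  rw [evenMap_smul_one, mulOp_zero, zero_mul, zero_add]

theorem mulOp_mem_of_mem_span {S : Set (Hol W)} {L : Submodule ℂ (Op W)}
    (hS : ∀ k ∈ S, mulOp k ∈ L) {k : Hol W} (hk : k ∈ Submodule.span ℂ S) : mulOp k ∈ L := by
  have : Submodule.span ℂ S ≤
      L.comap (evenMap W ∘ₗ LinearMap.inr ℂ _ _ ∘ₗ LinearMap.inr ℂ _ _) :=
    Submodule.span_le.2 fun k hk => by
      change evenMap W (0, 0, k) ∈ L
      rw [evenMap_zero_zero]
      exact hS k hk
  have h := this hk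
  change evenMap W (0, 0, k) ∈ L at h
  rwa [evenMap_zero_zero] at h

/-- The functions `h` such that the operator of multiplication by `h` belongs to the space. -/
def functionSpace (M : Submodule ℂ (Coeff W)) : Submodule ℂ (Hol W) :=
  M.comap (LinearMap.inr ℂ (Hol W) (Hol W × Hol W) ∘ₗ LinearMap.inr ℂ (Hol W) (Hol W))

theorem mem_functionSpace {M : Submodule ℂ (Coeff W)} {k : Hol W} :
    k ∈ functionSpace M ↔ ((0, 0, k) : Coeff W) ∈ M := Iff.rfl

theorem IsAdmissible.finiteDimensional_functionSpace {M : Submodule ℂ (Coeff W)}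
    (hM : IsAdmissible M) : FiniteDimensional ℂ (functionSpace M) := by
  have := hM.finiteDimensional
  exact finiteDimensional_comap M fun a b h => by
    simpa using h

/-- The operators without `∂_z` term are spanned by multiplication operators and at most one
operator `θ∂_θ + h₁`. -/
theorem IsAdmissible.exists_generator {M : Submodule ℂ (Coeff W)} (hM : IsAdmissible M) :
    ∃ (ε : ℂ) (h₁ : Hol W), (ε = 0 ∨ ε = 1) ∧ (ε = 0 → h₁ = 0) ∧ (0, ε • 1, h₁) ∈ M ∧
      ∀ g h, ((0, g, h) : Coeff W) ∈ M →
        ∃ c : ℂ, g = (c * ε) • (1 : Hol W) ∧ h - c • h₁ ∈ functionSpace M := by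
  by_cases h0 : ∀ g h, ((0, g, h) : Coeff W) ∈ M → g = 0
  · refine ⟨0, 0, Or.inl rfl, fun _ => rfl, ?_, fun g h hgh => ⟨0, ?_, ?_⟩⟩
    · rw [zero_smul]
      exact M.zero_mem
    · rw [h0 g h hgh, mul_zero, zero_smul]
    · obtain rfl := h0 g h hgh
      rwa [zero_smul, sub_zero]
  · push Not at h0
    obtain ⟨g₁, h₁, hm, hne⟩ := h0
    obtain ⟨a, rfl⟩ := hM.const g₁ h₁ hm
    have ha : a ≠ 0 := fun h => hne (by rw [h, zero_smul])
    have hgen : (0, (1 : ℂ) • 1, a⁻¹ • h₁) ∈ M := by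
      have := M.smul_mem a⁻¹ hm
      simpa [smul_smul, ha] using this
    refine ⟨1, a⁻¹ • h₁, Or.inr rfl, fun h => absurd h one_ne_zero, hgen, fun g h hgh => ?_⟩
    obtain ⟨c, rfl⟩ := hM.const g h hgh
    refine ⟨c, by rw [mul_one], ?_⟩
    have := M.sub_mem hgh (M.smul_mem c hgen)
    rw [mem_functionSpace]
    simpa using this

/-- The normal form of an algebra without vector fields. -/
theorem IsAdmissible.isType0 {M : Submodule ℂ (Coeff W)} (hM : IsAdmissible M)
    (hf : ∀ x ∈ M, x.1 = 0) : IsType0 (M.map (evenMap W)) := by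
  obtain ⟨ε, h₁, hε, -, hgen, hall⟩ := hM.exists_generator
  have := hM.finiteDimensional_functionSpace
  let b := Module.finBasis ℂ (functionSpace M)
  have hb : Submodule.span ℂ (Set.range fun i => (b i : Hol W)) = functionSpace M := by
    rw [show (fun i => (b i : Hol W)) = (functionSpace M).subtype ∘ b from rfl, Set.range_comp,
      ← Submodule.map_span, b.span_eq, Submodule.map_subtype_top]
  refine ⟨ε, h₁, _, fun i => (b i : Hol W), hε,
    b.linearIndependent.map' (functionSpace M).subtype (Submodule.ker_subtype _), ?_⟩
  apply le_antisymm
  · rintro _ ⟨⟨f, g, h⟩, hx, rfl⟩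
    obtain rfl : f = 0 := hf _ hx
    obtain ⟨c, rfl, hc⟩ := hall g h hx
    have e : ((0, (c * ε) • 1, h) : Coeff W) = c • (0, ε • 1, h₁) + (0, 0, h - c • h₁) := by
      simp [smul_smul]
    rw [e, map_add, map_smul, evenMap_zero_zero, evenMap_zero_smul_one]
    refine add_mem (Submodule.smul_mem _ _ (Submodule.subset_span (Or.inl rfl))) ?_
    rw [← hb] at hc
    refine mulOp_mem_of_mem_span ?_ hc
    rintro _ ⟨i, rfl⟩
    exact Submodule.subset_span (Or.inr ⟨i, rfl⟩)
  · refine Submodule.span_le.2 ?_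
    rintro _ (rfl | ⟨i, rfl⟩)
    · exact ⟨_, hgen, evenMap_zero_smul_one _ _⟩
    · exact ⟨_, (b i).2, evenMap_zero_zero _⟩

/-- Integration by parts, by induction on `l`; for `σ ≠ 0` the primitive needs no power of `z`
higher than `l`. -/
theorem exists_derivHol_eq_expMonomial {H : Submodule ℂ (Hol W)} {σ : ℂ} (hσ : σ ≠ 0) (l : ℕ)
    (h : ∀ j ≤ l, coord W ^ j * expFun W σ ∈ H) :
    ∃ P ∈ H, derivHol W P = coord W ^ l * expFun W σ := by
  induction l with
  | zero =>
    refine ⟨σ⁻¹ • (coord W ^ 0 * expFun W σ), H.smul_mem _ (h 0 le_rfl), ?_⟩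
    rw [pow_zero, one_mul, map_smul, derivHol_expFun, inv_smul_smul₀ hσ]
  | succ l ih =>
    obtain ⟨P, hP, e⟩ := ih fun j hj => h j (by omega)
    refine ⟨σ⁻¹ • (coord W ^ (l + 1) * expFun W σ - ((l : ℂ) + 1) • P),
      H.smul_mem _ (H.sub_mem (h _ le_rfl) (H.smul_mem _ hP)), ?_⟩
    rw [map_smul, map_sub, derivHol_mul, derivHol_coord_pow, derivHol_expFun, map_smul, e,
      Nat.add_sub_cancel]
    push_cast
    rw [smul_mul_assoc, add_sub_cancel_left, mul_smul_comm, inv_smul_smul₀ hσ]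

/-- A function whose derivative is a combination of exponential monomials is, up to such a
combination, a multiple of the first missing power of `z`. -/
theorem exists_sub_smul_coord_pow_mem (hW : IsPreconnected (W : Set ℂ)) {H : Submodule ℂ (Hol W)}
    {S : Finset ℂ} {s : ℂ → ℕ}
    (hH : H = Submodule.span ℂ {k | ∃ σ ∈ S, ∃ l ≤ s σ, k = coord W ^ l * expFun W σ})
    {k : Hol W} (hk : derivHol W k ∈ H) :
    ∃ α : ℂ, k - α • coord W ^ (if (0 : ℂ) ∈ S then s 0 + 1 else 0) ∈ H := by
  set N := if (0 : ℂ) ∈ S then s 0 + 1 else 0 with hN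
  -- `N` is the first exponent missing from the pure powers in `H`. Adjoining `z ^ N` is enough to
  -- integrate all of `H`: only `σ = 0` raises the degree, and the constants of integration also lie
  -- in `K`.
  set K := H ⊔ Submodule.span ℂ {coord W ^ N} with hK
  have hmem : ∀ σ ∈ S, ∀ l ≤ s σ, coord W ^ l * expFun W σ ∈ H := fun σ hσ l hl => by
    rw [hH]
    exact Submodule.subset_span ⟨σ, hσ, l, hl, rfl⟩
  have hpow : ∀ l ≤ N, coord W ^ l ∈ K := by
    intro l hl
    rcases hl.lt_or_eq with hl | rfl
    · by_cases h0 : (0 : ℂ) ∈ S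
      · rw [hN, if_pos h0] at hl
        have := hmem 0 h0 l (by omega)
        rw [expFun_zero, mul_one] at this
        exact Submodule.mem_sup_left this
      · rw [hN, if_neg h0] at hl
        omega
    · exact Submodule.mem_sup_right (Submodule.mem_span_singleton_self _)
  have hprim : H ≤ K.map (derivHol W) := by
    conv_lhs => rw [hH]
    refine Submodule.span_le.2 ?_
    rintro _ ⟨σ, hσ, l, hl, rfl⟩
    by_cases h0 : σ = 0
    · subst h0
      refine ⟨((l : ℂ) + 1)⁻¹ • coord W ^ (l + 1), K.smul_mem _ (hpow _ ?_), ?_⟩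
      · rw [hN, if_pos hσ]
        omega
      · rw [map_smul, derivHol_coord_pow, smul_smul, expFun_zero, mul_one]
        push_cast
        rw [inv_mul_cancel₀ (Nat.cast_add_one_ne_zero _), one_smul]
    · obtain ⟨P, hP, e⟩ := exists_derivHol_eq_expMonomial h0 l fun j hj =>
        hmem σ hσ j (hj.trans hl)
      exact ⟨P, Submodule.mem_sup_left hP, e⟩
  obtain ⟨P, hP, e⟩ := hprim hk
  obtain ⟨c, hc⟩ := Hol.exists_eq_smul_one_of_derivHol_eq_zero hW (f := k - P)
    (by rw [map_sub, e, sub_self])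
  have hkK : k ∈ K := by
    rw [← sub_add_cancel k P, hc]
    refine K.add_mem (K.smul_mem _ ?_) hP
    simpa using hpow 0 (Nat.zero_le _)
  obtain ⟨a, ha, b, hb, hab⟩ := Submodule.mem_sup.1 hkK
  obtain ⟨α, rfl⟩ := Submodule.mem_span_singleton.1 hb
  exact ⟨α, by rwa [← hab, add_sub_cancel_right]⟩

theorem bracket_one_left (x : Coeff W) :
    bracket (1, 0, 0) x = (derivHol W x.1, derivHol W x.2.1, derivHol W x.2.2) := by
  simp [bracket, derivHol_one]

theorem derivHol_smul_one (c : ℂ) : derivHol W (c • (1 : Hol W)) = 0 := by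
  rw [map_smul, derivHol_one, smul_zero]

/-- The normal form of an algebra whose only vector field is `∂_z`. -/
theorem IsAdmissible.isType1 (hW : IsPreconnected (W : Set ℂ)) {M : Submodule ℂ (Coeff W)}
    (hM : IsAdmissible M) (h1 : (1, 0, 0) ∈ M) (hf : ∀ x ∈ M, ∃ c : ℂ, x.1 = c • (1 : Hol W)) :
    IsType1 (M.map (evenMap W)) := by
  obtain ⟨ε, h₁, hε, hε0, hgen, hall⟩ := hM.exists_generator
  have := hM.finiteDimensional_functionSpace
  have hder : ∀ k ∈ functionSpace M, derivHol W k ∈ functionSpace M := fun k hk => by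
    have := hM.closed _ h1 _ hk
    rw [bracket_one_left] at this
    simpa [mem_functionSpace] using this
  obtain ⟨S, s, hS⟩ := exists_eq_span_expMonomials hW (functionSpace M) hder
  obtain ⟨α, hα0, hα⟩ : ∃ α : ℂ, (ε = 0 → α = 0) ∧
      h₁ - α • coord W ^ (if (0 : ℂ) ∈ S then s 0 + 1 else 0) ∈ functionSpace M := by
    by_cases h0 : ε = 0
    · refine ⟨0, fun _ => rfl, ?_⟩
      rw [hε0 h0, zero_smul, sub_zero]
      exact zero_mem _
    · have hd : derivHol W h₁ ∈ functionSpace M := by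
        have := hM.closed _ h1 _ hgen
        rw [bracket_one_left] at this
        simpa [mem_functionSpace, derivHol_one] using this
      obtain ⟨α, hα⟩ := exists_sub_smul_coord_pow_mem hW hS hd
      exact ⟨α, fun h => absurd h h0, hα⟩
  refine ⟨ε, α, S, s, hε, hα0, ?_⟩
  set N := if (0 : ℂ) ∈ S then s 0 + 1 else 0
  apply le_antisymm
  · rintro _ ⟨⟨f, g, h⟩, hx, rfl⟩
    obtain ⟨a, ha⟩ := hf _ hx
    obtain rfl : f = a • 1 := ha
    have hx' : ((0, g, h) : Coeff W) ∈ M := by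
      have := M.sub_mem hx (M.smul_mem a h1)
      simpa using this
    obtain ⟨c, rfl, hc⟩ := hall g h hx'
    have e : ((a • 1, (c * ε) • 1, h) : Coeff W) = a • (1, 0, 0) +
        c • (0, ε • 1, α • coord W ^ N) + (0, 0, (h - c • h₁) + c • (h₁ - α • coord W ^ N)) := by
      simp [smul_smul, smul_sub]
    rw [e, map_add, map_add, map_smul, map_smul, evenMap_zero_zero, evenMap_zero_smul_one,
      evenMap_one, mulOp_smul]
    refine add_mem (add_mem (Submodule.smul_mem _ _ (Submodule.subset_span (by simp)))
      (Submodule.smul_mem _ _ (Submodule.subset_span (by simp)))) ?_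
    have hmem := Submodule.add_mem _ hc (Submodule.smul_mem _ c hα)
    rw [hS] at hmem
    refine mulOp_mem_of_mem_span ?_ hmem
    rintro _ ⟨σ, hσ, l, hl, rfl⟩
    exact Submodule.subset_span (Or.inr ⟨σ, hσ, l, hl, rfl⟩)
  · refine Submodule.span_le.2 ?_
    rintro _ ((rfl | rfl) | ⟨σ, hσ, l, hl, rfl⟩)
    · exact ⟨_, h1, evenMap_one⟩
    · refine ⟨(0, ε • 1, α • coord W ^ N), ?_, ?_⟩
      · have := M.sub_mem hgen (mem_functionSpace.1 hα)
        simpa using this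
      · rw [evenMap_zero_smul_one, mulOp_smul]
    · refine ⟨_, mem_functionSpace.1 (hS ▸ Submodule.subset_span ⟨σ, hσ, l, hl, rfl⟩),
        evenMap_zero_zero _⟩

end NormalForms

/-! ### Normal forms in the presence of `z ∂_z`: polynomial functions and vector fields. -/

section PolynomialForms

variable {W : Opens ℂ}

theorem derivHol_pow_self (n : ℕ) :
    (derivHol W ^ n) (coord W ^ n) = (n.factorial : ℂ) • (1 : Hol W) := by
  induction n with
  | zero => simp
  | succ n ih =>
    rw [pow_succ, Module.End.mul_apply, derivHol_coord_pow, map_smul, Nat.add_sub_cancel, ih,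
      smul_smul, Nat.factorial_succ]
    push_cast
    rfl

theorem polySpace_mono {m n : ℕ} (h : m ≤ n) : polySpace W m ≤ polySpace W n :=
  Submodule.span_le.2 fun _ ⟨l, e⟩ => e ▸ coord_pow_mem_polySpace (l.2.trans_le h)

theorem lt_of_coord_pow_mem_polySpace (hW : IsConnected (W : Set ℂ)) {m n : ℕ}
    (h : coord W ^ m ∈ polySpace W n) : m < n := by
  by_contra hmn
  have h' := (mem_polySpace_iff hW.isPreconnected).1 (polySpace_mono (not_lt.1 hmn) h)
  rw [derivHol_pow_self] at h'
  obtain ⟨x, hx⟩ := hW.nonempty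
  have := congrArg (fun k : Hol W => k ⟨x, hx⟩) h'
  simp only [Hol.smul_apply, Hol.one_apply, Hol.zero_apply, mul_one] at this
  exact Nat.factorial_ne_zero m (by exact_mod_cast this)

theorem exists_sub_smul_mem_polySpace {n : ℕ} {k : Hol W} (hk : k ∈ polySpace W (n + 1)) :
    ∃ t : ℂ, k - t • coord W ^ n ∈ polySpace W n := by
  have hle : polySpace W (n + 1) ≤ polySpace W n ⊔ Submodule.span ℂ {coord W ^ n} := by
    refine Submodule.span_le.2 ?_
    rintro _ ⟨l, rfl⟩
    rcases (Nat.lt_succ_iff.1 l.2).lt_or_eq with h | h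
    · exact Submodule.mem_sup_left (coord_pow_mem_polySpace h)
    · refine Submodule.mem_sup_right ?_
      simp only [h]
      exact Submodule.mem_span_singleton_self _
  obtain ⟨a, ha, b, hb, hab⟩ := Submodule.mem_sup.1 (hle hk)
  obtain ⟨t, rfl⟩ := Submodule.mem_span_singleton.1 hb
  exact ⟨t, by rwa [← hab, add_sub_cancel_right]⟩

theorem polySpace_zero : polySpace W 0 = ⊥ := by
  simp [polySpace]

theorem derivHol_pow_coord_mul (n : ℕ) (k : Hol W) :
    (derivHol W ^ (n + 1)) (coord W * k) =
      coord W * (derivHol W ^ (n + 1)) k + ((n : ℂ) + 1) • (derivHol W ^ n) k := by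
  induction n generalizing k with
  | zero =>
    simp only [zero_add, pow_one, pow_zero, Module.End.one_apply, derivHol_mul, derivHol_coord]
    simp [add_comm]
  | succ n ih =>
    rw [pow_succ, Module.End.mul_apply, derivHol_mul, derivHol_coord, one_mul, map_add, ih,
      show (derivHol W ^ n) (derivHol W k) = (derivHol W ^ (n + 1)) k by rw [pow_succ]; rfl,
      Module.End.mul_apply]
    push_cast
    module

/-- If `z k'` has degree less than `n` with `n > 0`, then so does `k`, and no constant is needed.
For `n = 0` the condition is `k' = 0`, and the constant itself is subtracted. -/
theorem exists_sub_smul_one_mem_polySpace (hW : IsPreconnected (W : Set ℂ)) {n : ℕ} {k : Hol W}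
    (hD : derivHol W k ∈ polySpace W n) (hE : coord W * derivHol W k ∈ polySpace W n) :
    ∃ γ : ℂ, k - γ • (1 : Hol W) ∈ polySpace W n := by
  cases n with
  | zero =>
    rw [polySpace_zero, Submodule.mem_bot] at hD
    obtain ⟨c, rfl⟩ := Hol.exists_eq_smul_one_of_derivHol_eq_zero hW hD
    exact ⟨c, by rw [sub_self]; exact zero_mem _⟩
  | succ n =>
    refine ⟨0, ?_⟩
    rw [zero_smul, sub_zero, mem_polySpace_iff hW, pow_succ, Module.End.mul_apply]
    rw [mem_polySpace_iff hW] at hD hE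
    rw [derivHol_pow_coord_mul, hD, mul_zero, zero_add] at hE
    exact (smul_eq_zero.1 hE).resolve_left (Nat.cast_add_one_ne_zero n)

/-- A gauge by `p` adds `z p` to the function part of the operator over `z ∂_z`. For `n > 0` this
cancels the top term `t z ^ n` with `p = -t z ^ (n - 1)`; for `n = 0` the top term is the constant
`β`, which survives. -/
theorem exists_add_coord_mul_mem_polySpace {n : ℕ} {k : Hol W} (hk : k ∈ polySpace W (n + 1)) :
    ∃ p ∈ polySpace W n, ∃ β : ℂ, k + coord W * p - β • (1 : Hol W) ∈ polySpace W n := by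
  obtain ⟨t, ht⟩ := exists_sub_smul_mem_polySpace hk
  cases n with
  | zero =>
    refine ⟨0, zero_mem _, t, ?_⟩
    rwa [mul_zero, add_zero, ← pow_zero (coord W)]
  | succ n =>
    refine ⟨-(t • coord W ^ n),
      Submodule.neg_mem _ (Submodule.smul_mem _ _ (coord_pow_mem_polySpace n.lt_succ_self)),
      0, ?_⟩
    rwa [zero_smul, sub_zero, mul_neg, mul_smul_comm, ← pow_succ', ← sub_eq_add_neg]

/-- The operators without `∂_z` term in the space are spanned by `ε θ∂_θ + γ` and the powers `z^l`
with `l < n`. -/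
structure HasPolynomialIdeal (M : Submodule ℂ (Coeff W)) (ε γ : ℂ) (n : ℕ) : Prop where
  functionSpace_eq : functionSpace M = polySpace W n
  generator_mem : ((0, ε • 1, γ • 1) : Coeff W) ∈ M
  exists_of_mem : ∀ g h, ((0, g, h) : Coeff W) ∈ M →
    ∃ c : ℂ, g = (c * ε) • (1 : Hol W) ∧ h - (c * γ) • (1 : Hol W) ∈ polySpace W n

theorem HasPolynomialIdeal.evenMap_mem {M : Submodule ℂ (Coeff W)} {ε γ : ℂ} {n : ℕ}
    (hI : HasPolynomialIdeal M ε γ n) {L : Submodule ℂ (Op W)}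
    (hgen : ε • (theta W * dtheta W) + γ • (1 : Op W) ∈ L)
    (hpow : ∀ l < n, mulOp (coord W ^ l) ∈ L) {g h : Hol W} (hx : ((0, g, h) : Coeff W) ∈ M) :
    evenMap W (0, g, h) ∈ L := by
  obtain ⟨c, rfl, hc⟩ := hI.exists_of_mem g h hx
  have e : ((0, (c * ε) • 1, h) : Coeff W) = c • (0, ε • 1, γ • 1) +
      (0, 0, h - (c * γ) • 1) := by
    simp [smul_smul]
  rw [e, map_add, map_smul, evenMap_zero_zero, evenMap_zero_smul_one, mulOp_smul, mulOp_one]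
  refine L.add_mem (L.smul_mem _ hgen) (mulOp_mem_of_mem_span ?_ hc)
  rintro _ ⟨l, rfl⟩
  exact hpow l l.2

/-- Brackets with the operators over `∂_z` and `z ∂_z` make the function space stable under `d/dz`
and `z d/dz`. Applied to the generator `ε θ∂_θ + h₁`, they put `h₁'` and `z h₁'` in that space, so
`h₁` can be replaced by a constant. -/
theorem IsAdmissible.exists_hasPolynomialIdeal (hW : IsPreconnected (W : Set ℂ))
    {M : Submodule ℂ (Coeff W)} (hM : IsAdmissible M) (h1 : (1, 0, 0) ∈ M) {g h : Hol W}
    (hz : (coord W, g, h) ∈ M) :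
    ∃ (ε γ : ℂ) (n : ℕ), (ε = 0 ∨ ε = 1) ∧ HasPolynomialIdeal M ε γ n := by
  obtain ⟨ε, h₁, hε, -, hgen, hall⟩ := hM.exists_generator
  have := hM.finiteDimensional_functionSpace
  have hder : ∀ c : ℂ, ∀ k, ((0, c • 1, k) : Coeff W) ∈ M → derivHol W k ∈ functionSpace M :=
    fun c k hk => by
      have := hM.closed _ h1 _ hk
      rw [bracket_one_left] at this
      simpa [mem_functionSpace, derivHol_one] using this
  have heul : ∀ c : ℂ, ∀ k, ((0, c • 1, k) : Coeff W) ∈ M →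
      coord W * derivHol W k ∈ functionSpace M := fun c k hk => by
    have := hM.closed _ hz _ hk
    simpa [bracket, mem_functionSpace, derivHol_one] using this
  have hzero : ∀ k ∈ functionSpace M, ((0, (0 : ℂ) • 1, k) : Coeff W) ∈ M := fun k hk => by
    rwa [zero_smul]
  have hpoly := eq_polySpace_of_euler hW (functionSpace M) (fun k hk => hder 0 k (hzero k hk))
    (fun k hk => heul 0 k (hzero k hk))
  set n := Module.finrank ℂ (functionSpace M)
  have hD := hder ε h₁ hgen
  have hE := heul ε h₁ hgen
  rw [hpoly] at hD hE
  obtain ⟨γ, hγ⟩ := exists_sub_smul_one_mem_polySpace hW hD hE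
  refine ⟨ε, γ, n, hε, hpoly, ?_, fun g h hgh => ?_⟩
  · rw [← hpoly, mem_functionSpace] at hγ
    have := M.sub_mem hgen hγ
    simpa using this
  · obtain ⟨c, e, hc⟩ := hall g h hgh
    refine ⟨c, e, ?_⟩
    rw [hpoly] at hc
    have := Submodule.add_mem _ hc (Submodule.smul_mem _ c hγ)
    rwa [smul_sub, smul_smul, sub_add_sub_cancel] at this

theorem zero_mem_map_gauge_iff {M : Submodule ℂ (Coeff W)} {q p g h : Hol W} :
    ((0, g, h) : Coeff W) ∈ M.map (gauge q p) ↔ ((0, g, h) : Coeff W) ∈ M := by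
  constructor
  · rintro ⟨⟨f', g', h'⟩, hx, e⟩
    rw [gauge_apply, Prod.mk.injEq, Prod.mk.injEq] at e
    obtain ⟨rfl, rfl, rfl⟩ := e
    rwa [zero_mul, add_zero, zero_mul, add_zero]
  · intro hx
    refine ⟨_, hx, ?_⟩
    rw [gauge_apply, zero_mul, add_zero, zero_mul, add_zero]

theorem HasPolynomialIdeal.map_gauge {M : Submodule ℂ (Coeff W)} {ε γ : ℂ} {n : ℕ}
    (hI : HasPolynomialIdeal M ε γ n) (q p : Hol W) :
    HasPolynomialIdeal (M.map (gauge q p)) ε γ n where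
  functionSpace_eq := by
    rw [← hI.functionSpace_eq]
    ext k
    exact zero_mem_map_gauge_iff
  generator_mem := zero_mem_map_gauge_iff.2 hI.generator_mem
  exists_of_mem g h hx := hI.exists_of_mem g h (zero_mem_map_gauge_iff.1 hx)

/-- A gauge transformation brings the operator with vector field `z∂_z` into the form
`z∂_z + α θ∂_θ + β`, keeping `∂_z`. -/
theorem HasPolynomialIdeal.exists_gauge (hW : IsPreconnected (W : Set ℂ))
    {M : Submodule ℂ (Coeff W)} (hM : IsAdmissible M) {ε γ : ℂ} {n : ℕ}
    (hI : HasPolynomialIdeal M ε γ n) (h1 : (1, 0, 0) ∈ M) {g h : Hol W}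
    (hz : (coord W, g, h) ∈ M) :
    ∃ (q p : Hol W) (α β : ℂ), (1, 0, 0) ∈ M.map (gauge q p) ∧
      (coord W, α • 1, β • 1) ∈ M.map (gauge q p) := by
  -- This is `[∂_z, z∂_z + …] - ∂_z`. It shows that `g` is `c ε z` plus a constant and `h` is `c γ
  -- z` plus a polynomial of degree at most `n`.
  have hd : ((0, derivHol W g, derivHol W h) : Coeff W) ∈ M := by
    have := M.sub_mem (hM.closed _ h1 _ hz) h1
    rw [bracket_one_left, derivHol_coord] at this
    simpa using this
  obtain ⟨c, hg, hh⟩ := hI.exists_of_mem _ _ hd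
  obtain ⟨α, hα⟩ := Hol.exists_eq_smul_one_of_derivHol_eq_zero hW
    (f := g - (c * ε) • coord W) (by rw [map_sub, map_smul, derivHol_coord, hg, sub_self])
  have hk : h - (c * γ) • coord W ∈ polySpace W (n + 1) := by
    rw [mem_polySpace_iff hW, pow_succ, Module.End.mul_apply, ← mem_polySpace_iff hW, map_sub,
      map_smul, derivHol_coord]
    exact hh
  obtain ⟨p, hp, β, hβ⟩ := exists_add_coord_mul_mem_polySpace hk
  rw [← hI.functionSpace_eq, mem_functionSpace] at hp hβ
  -- The gauge is chosen with `(0, q, p)` in `M`: then `(1, -q, -p)` is in `M` and is sent to `∂_z`,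
  -- so that operator is not lost.
  have hqp : ((0, -((c * ε) • 1), -((c * γ) • 1) + p) : Coeff W) ∈ M := by
    have := M.add_mem (M.smul_mem (-c) hI.generator_mem) hp
    simpa [smul_smul] using this
  refine ⟨-((c * ε) • 1), -((c * γ) • 1) + p, α, β, ?_, ?_⟩
  · refine ⟨(1, 0, 0) - (0, -((c * ε) • 1), -((c * γ) • 1) + p), M.sub_mem h1 hqp, ?_⟩
    rw [Prod.mk_sub_mk, Prod.mk_sub_mk, gauge_apply]
    simp
  · refine ⟨(coord W, g, h) -
      (0, 0, h - (c * γ) • coord W + coord W * p - β • (1 : Hol W)), M.sub_mem hz hβ, ?_⟩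
    rw [Prod.mk_sub_mk, Prod.mk_sub_mk, gauge_apply]
    refine Prod.ext (sub_zero _) (Prod.ext ?_ ?_)
    · rw [← hα]
      simp only [sub_zero, mul_neg, mul_smul_comm, mul_one]
      abel
    · simp only [sub_zero, mul_add, mul_neg, mul_smul_comm, mul_one]
      abel

theorem HasPolynomialIdeal.isType2 {M : Submodule ℂ (Coeff W)} {ε γ α β : ℂ} {n : ℕ}
    (hε : ε = 0 ∨ ε = 1) (hI : HasPolynomialIdeal M ε γ n) (h1 : (1, 0, 0) ∈ M)
    (hz : (coord W, α • 1, β • 1) ∈ M)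
    (hf : ∀ x ∈ M, ∃ a b : ℂ, x.1 = a • (1 : Hol W) + b • coord W) :
    IsType2 (M.map (evenMap W)) := by
  refine ⟨ε, α, β, γ, n, hε, ?_⟩
  have ez : evenMap W (coord W, α • 1, β • 1) =
      mulOp (coord W) * dz W + α • (theta W * dtheta W) + β • (1 : Op W) := by
    rw [evenMap_smul_one, mulOp_smul, mulOp_one]
  apply le_antisymm
  · rintro _ ⟨x, hx, rfl⟩
    obtain ⟨a, b, e⟩ := hf x hx
    set u : Coeff W := (1, 0, 0) with hu
    set v : Coeff W := (coord W, α • 1, β • 1) with hv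
    set y := x - a • u - b • v with hy
    have hyM : y ∈ M := M.sub_mem (M.sub_mem hx (M.smul_mem a h1)) (M.smul_mem b hz)
    have hy0 : y = (0, y.2.1, y.2.2) := by
      refine Prod.ext ?_ rfl
      simp only [hy, hu, hv, Prod.fst_sub, Prod.smul_fst, e]
      abel
    rw [show x = a • u + b • v + y by rw [hy]; abel, map_add, map_add, map_smul, map_smul,
      evenMap_one, ez]
    refine add_mem (add_mem (Submodule.smul_mem _ _ (Submodule.subset_span (by simp)))
      (Submodule.smul_mem _ _ (Submodule.subset_span (by simp)))) ?_
    rw [hy0] at hyM ⊢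
    exact hI.evenMap_mem (Submodule.subset_span (by simp))
      (fun l hl => Submodule.subset_span (Or.inr ⟨l, hl, rfl⟩)) hyM
  · refine Submodule.span_le.2 ?_
    rintro _ ((rfl | rfl | rfl) | ⟨l, hl, rfl⟩)
    · exact ⟨_, h1, evenMap_one⟩
    · exact ⟨_, hz, ez⟩
    · exact ⟨_, hI.generator_mem, by rw [evenMap_zero_smul_one, mulOp_smul, mulOp_one]⟩
    · refine ⟨_, mem_functionSpace.1 ?_, evenMap_zero_zero _⟩
      rw [hI.functionSpace_eq]
      exact coord_pow_mem_polySpace hl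

theorem HasPolynomialIdeal.isType3 {M : Submodule ℂ (Coeff W)} {ε γ α β : ℂ} {n : ℕ}
    (hε : ε = 0 ∨ ε = 1) (hI : HasPolynomialIdeal M ε γ n) (hn : n ≤ 1) (h1 : (1, 0, 0) ∈ M)
    (hz : (coord W, α • 1, β • 1) ∈ M)
    (hz2 : (coord W ^ 2, (2 * α) • coord W, (2 * β) • coord W) ∈ M)
    (hf : ∀ x ∈ M, ∃ a b c : ℂ, x.1 = a • (1 : Hol W) + b • coord W + c • coord W ^ 2) :
    IsType3 (M.map (evenMap W)) := by
  -- As `n ≤ 1`, the multiplication operators in the space are the constants when `n = 1` and only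
  -- zero otherwise.
  refine ⟨ε, α, β, γ, n = 1, hε, ?_⟩
  have ez : evenMap W (coord W, α • 1, β • 1) =
      mulOp (coord W) * dz W + α • (theta W * dtheta W) + β • (1 : Op W) := by
    rw [evenMap_smul_one, mulOp_smul, mulOp_one]
  have ez2 : evenMap W (coord W ^ 2, (2 * α) • coord W, (2 * β) • coord W) =
      mulOp (coord W ^ 2) * dz W + (2 * α) • (mulOp (coord W) * theta W * dtheta W)
          + (2 * β) • mulOp (coord W) := by
    change evenOp _ _ _ = _
    rw [evenOp, mulOp_smul, mulOp_smul, smul_mul_assoc, smul_mul_assoc]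
  apply le_antisymm
  · rintro _ ⟨x, hx, rfl⟩
    obtain ⟨a, b, c, e⟩ := hf x hx
    set u : Coeff W := (1, 0, 0) with hu
    set v : Coeff W := (coord W, α • 1, β • 1) with hv
    set w : Coeff W := (coord W ^ 2, (2 * α) • coord W, (2 * β) • coord W) with hw
    set y := x - a • u - b • v - c • w with hy
    have hyM : y ∈ M := M.sub_mem (M.sub_mem (M.sub_mem hx (M.smul_mem a h1)) (M.smul_mem b hz))
      (M.smul_mem c hz2)
    have hy0 : y = (0, y.2.1, y.2.2) := by
      refine Prod.ext ?_ rfl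
      simp only [hy, hu, hv, hw, Prod.fst_sub, Prod.smul_fst, e]
      abel
    rw [show x = a • u + b • v + c • w + y by rw [hy]; abel, map_add, map_add, map_add, map_smul,
      map_smul, map_smul, evenMap_one, ez, ez2]
    refine add_mem (add_mem (add_mem (Submodule.smul_mem _ _ (Submodule.subset_span (by simp)))
      (Submodule.smul_mem _ _ (Submodule.subset_span (by simp))))
      (Submodule.smul_mem _ _ (Submodule.subset_span (by simp)))) ?_
    rw [hy0] at hyM ⊢
    refine hI.evenMap_mem (Submodule.subset_span (by simp))
      (fun l hl => Submodule.subset_span (Or.inr ⟨by omega, ?_⟩)) hyM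
    obtain rfl : l = 0 := by omega
    rw [pow_zero, mulOp_one]
  · refine Submodule.span_le.2 ?_
    rintro _ ((rfl | rfl | rfl | rfl) | ⟨hn1, rfl⟩)
    · exact ⟨_, h1, evenMap_one⟩
    · exact ⟨_, hz, ez⟩
    · exact ⟨_, hz2, ez2⟩
    · exact ⟨_, hI.generator_mem, by rw [evenMap_zero_smul_one, mulOp_smul, mulOp_one]⟩
    · refine ⟨(0, 0, 1), mem_functionSpace.1 ?_, by rw [evenMap_zero_zero, mulOp_one]⟩
      rw [hI.functionSpace_eq, ← pow_zero (coord W)]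
      exact coord_pow_mem_polySpace (by omega)

/-- The normal form of an algebra containing `∂_z` and an operator `z∂_z + α θ∂_θ + β`. -/
theorem HasPolynomialIdeal.isType2_or_isType3 (hW : IsConnected (W : Set ℂ))
    {M : Submodule ℂ (Coeff W)} (hM : IsAdmissible M) {ε γ α β : ℂ} {n : ℕ}
    (hε : ε = 0 ∨ ε = 1) (hI : HasPolynomialIdeal M ε γ n) (h1 : (1, 0, 0) ∈ M)
    (hz : (coord W, α • 1, β • 1) ∈ M) :
    IsType2 (M.map (evenMap W)) ∨ IsType3 (M.map (evenMap W)) := by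
  have := hM.finiteDimensional
  set F : Submodule ℂ (Hol W) := M.map (LinearMap.fst ℂ _ _) with hF
  have hder : ∀ f ∈ F, derivHol W f ∈ F := by
    rintro _ ⟨x, hx, rfl⟩
    have := hM.closed _ h1 _ hx
    rw [bracket_one_left] at this
    exact ⟨_, this, rfl⟩
  have hbr : ∀ f ∈ F, ∀ g ∈ F, f * derivHol W g - g * derivHol W f ∈ F := by
    rintro _ ⟨x, hx, rfl⟩ _ ⟨y, hy, rfl⟩
    exact ⟨_, hM.closed _ hx _ hy, rfl⟩
  have heul : ∀ f ∈ F, coord W * derivHol W f ∈ F := fun f hf => by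
    have := F.add_mem (hbr _ ⟨_, hz, rfl⟩ f hf) hf
    simpa [derivHol_coord] using this
  have hpoly := eq_polySpace_of_euler hW.isPreconnected F hder heul
  set d := Module.finrank ℂ F
  -- If `d = m + 4`, the bracket of the two top fields `z ^ (m + 2) ∂_z` and `z ^ (m + 3) ∂_z` is `z
  -- ^ (2m + 4) ∂_z`, whose degree is too large.
  have hd : d ≤ 3 := by
    by_contra! hd
    obtain ⟨m, hm⟩ := Nat.exists_eq_add_of_le' hd
    have hm' := hbr (coord W ^ (m + 2)) (hpoly ▸ coord_pow_mem_polySpace (by omega))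
      (coord W ^ (m + 3)) (hpoly ▸ coord_pow_mem_polySpace (by omega))
    have e : coord W ^ (m + 2) * derivHol W (coord W ^ (m + 3)) -
        coord W ^ (m + 3) * derivHol W (coord W ^ (m + 2)) = coord W ^ (2 * m + 4) := by
      rw [derivHol_coord_pow, derivHol_coord_pow, mul_smul_comm, mul_smul_comm, ← pow_add,
        ← pow_add, show m + 3 + (m + 2 - 1) = m + 2 + (m + 3 - 1) by omega, ← sub_smul,
        show m + 2 + (m + 3 - 1) = 2 * m + 4 by omega]
      push_cast
      rw [show (m : ℂ) + 3 - (m + 2) = 1 by ring, one_smul]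
    rw [e, hpoly] at hm'
    have := lt_of_coord_pow_mem_polySpace hW hm'
    omega
  have hpoly2 : ∀ f ∈ polySpace W 2, ∃ a b : ℂ, f = a • (1 : Hol W) + b • coord W := by
    intro f hf
    obtain ⟨b, hb⟩ := exists_sub_smul_mem_polySpace hf
    obtain ⟨a, ha⟩ := exists_sub_smul_mem_polySpace hb
    rw [polySpace_zero, Submodule.mem_bot, sub_sub, sub_eq_zero, pow_zero, pow_one] at ha
    exact ⟨a, b, ha.trans (add_comm _ _)⟩
  by_cases hd2 : d ≤ 2
  · refine Or.inl (hI.isType2 hε h1 hz fun x hx => hpoly2 _ (polySpace_mono hd2 ?_))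
    rw [← hpoly]
    exact ⟨x, hx, rfl⟩
  · have hd3 : d = 3 := by omega
    rw [hd3] at hpoly
    right
    obtain ⟨⟨f, g, h⟩, hz2, e⟩ : coord W ^ 2 ∈ F :=
      hpoly ▸ coord_pow_mem_polySpace (by omega)
    obtain rfl : f = coord W ^ 2 := e
    -- The operator over `z² ∂_z` sends the top power `z ^ (n - 1)` to `(n - 1) z ^ n`, which is
    -- outside the ideal unless `n ≤ 1`.
    have hn : n ≤ 1 := by
      by_contra! hn
      obtain ⟨m, rfl⟩ := Nat.exists_eq_add_of_le' hn
      have hm : coord W ^ (m + 1) ∈ functionSpace M :=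
        hI.functionSpace_eq ▸ coord_pow_mem_polySpace (by omega)
      have hb := hM.closed _ hz2 _ (mem_functionSpace.1 hm)
      have hb' : ((m : ℂ) + 1) • coord W ^ (m + 2) ∈ functionSpace M := by
        rw [mem_functionSpace]
        convert hb using 1
        simp only [bracket, map_zero, mul_zero, zero_mul, sub_zero, derivHol_coord_pow,
          mul_smul_comm, ← pow_add]
        rw [Nat.add_sub_cancel, add_comm 2 m]
        push_cast
        rw [smul_zero, sub_zero]
      have := (Submodule.smul_mem_iff _ (Nat.cast_add_one_ne_zero m)).1 hb'
      rw [hI.functionSpace_eq] at this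
      exact absurd (lt_of_coord_pow_mem_polySpace hW this) (lt_irrefl _)
    -- This is `[∂_z, z²∂_z + …] - 2 (z∂_z + …)`. Adding half of it to the operator over `z ∂_z`
    -- adjusts `α` and `β` so that `g' = 2α` and `h' = 2β`.
    have hd0 : ((0, derivHol W g - (2 * α) • 1, derivHol W h - (2 * β) • 1) : Coeff W) ∈ M := by
      have := M.sub_mem (hM.closed _ h1 _ hz2) (M.smul_mem 2 hz)
      rw [bracket_one_left, derivHol_coord_pow] at this
      simpa [smul_smul] using this
    obtain ⟨c, hg, hh⟩ := hI.exists_of_mem _ _ hd0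
    obtain ⟨b, hb⟩ : ∃ b : ℂ,
        derivHol W h - (2 * β) • 1 - (c * γ) • (1 : Hol W) = b • (1 : Hol W) := by
      obtain ⟨b, hb⟩ := exists_sub_smul_mem_polySpace (polySpace_mono hn hh)
      rw [polySpace_zero, Submodule.mem_bot, sub_eq_zero, pow_zero] at hb
      exact ⟨b, hb⟩
    have hz' : (coord W, (α + c * ε / 2) • 1, (β + (c * γ + b) / 2) • 1) ∈ M := by
      have := M.add_mem hz (M.smul_mem (1 / 2) hd0)
      convert this using 1
      rw [hg, show derivHol W h - (2 * β) • 1 = (c * γ + b) • (1 : Hol W) by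
        rw [add_smul, ← hb]; abel]
      simp only [Prod.smul_mk, Prod.mk_add_mk, smul_zero, add_zero, smul_smul, ← add_smul]
      congr 4 <;> ring
    have hDg : derivHol W g = (2 * (α + c * ε / 2)) • (1 : Hol W) := by
      rw [sub_eq_iff_eq_add.1 hg, ← add_smul]
      congr 1
      ring
    have hDh : derivHol W h = (2 * (β + (c * γ + b) / 2)) • (1 : Hol W) := by
      rw [sub_eq_iff_eq_add.1 (sub_eq_iff_eq_add.1 hb), ← add_smul, ← add_smul]
      congr 1
      ring
    refine hI.isType3 hε hn h1 hz' ?_ fun x hx => ?_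
    -- The bracket of the adjusted operator with that over `z² ∂_z` has coefficients `(z², z g', z
    -- h')`; this removes the integration constants of `g` and `h`.
    · have := hM.closed _ hz' _ hz2
      convert this using 1
      simp only [bracket, hDg, hDh, derivHol_smul_one, derivHol_coord, derivHol_coord_pow,
        mul_zero, sub_zero, mul_smul_comm, mul_one]
      refine Prod.ext ?_ rfl
      change coord W ^ 2 = ((2 : ℕ) : ℂ) • (coord W * coord W ^ 1) - coord W ^ 2
      rw [Nat.cast_smul_eq_nsmul]
      ring
    · have hx' : x.1 ∈ F := ⟨x, hx, rfl⟩
      rw [hpoly] at hx'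
      obtain ⟨t, ht⟩ := exists_sub_smul_mem_polySpace hx'
      obtain ⟨a, a', e⟩ := hpoly2 _ ht
      exact ⟨a, a', t, sub_eq_iff_eq_add.1 e⟩

end PolynomialForms

/-! ### Graded subalgebras -/

section Main

variable {U : Opens ℂ}

/-- An odd element forces the coefficient of `θ∂_θ` to be constant in every even element without
`∂_z` term. -/
theorem isAdmissible_coeffSpace (hU : IsConnected (U : Set ℂ)) {s : Submodule ℂ (Op U)}
    (hs : IsGradedSubalgebra s) (hfin : FiniteDimensional ℂ s) (hodd : oddPart s ≠ ⊥) :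
    IsAdmissible (coeffSpace s) where
  finiteDimensional := inferInstance
  closed := isBracketClosed_coeffSpace hs
  const := by
    intro g h hgh
    set N : Submodule ℂ (Coeff U) := s.comap (oddMap U) with hN
    have : FiniteDimensional ℂ N := finiteDimensional_comap s oddMap_injective
    have hstab : ∀ φ χ ω : Hol U, (φ, χ, ω) ∈ N →
        (g * φ, -(g * χ), g * ω - φ * derivHol U h) ∈ N := fun φ χ ω hx => by
      change oddOp _ _ _ ∈ s
      rw [← evenOp_oddOp_bracket]
      exact hs.even_odd _ ⟨hgh, 0, g, h, rfl⟩ _ ⟨hx, φ, χ, ω, rfl⟩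
    obtain ⟨_, ⟨hT, φ₀, χ₀, ω₀, rfl⟩, hne⟩ := (Submodule.ne_bot_iff _).1 hodd
    have hx₀ : (φ₀, χ₀, ω₀) ∈ N := hT
    -- The space stable under `g` is the projection of the odd part to `φ`, `χ` or `ω`, whichever is
    -- the first not identically zero.
    by_cases hφ : ∀ x ∈ N, x.1 = 0
    · by_cases hχ : ∀ x ∈ N, x.2.1 = 0
      · refine Hol.exists_eq_smul_one_of_mul_mem hU.isPreconnected
          (N.map (LinearMap.snd ℂ _ _ ∘ₗ LinearMap.snd ℂ _ _)) ?_ ?_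
        · rw [Submodule.ne_bot_iff]
          refine ⟨ω₀, ⟨_, hx₀, rfl⟩, ?_⟩
          rintro rfl
          obtain rfl : φ₀ = 0 := hφ _ hx₀
          obtain rfl : χ₀ = 0 := hχ _ hx₀
          exact hne (map_zero (oddMap U))
        · rintro _ ⟨⟨φ, χ, ω⟩, hx, rfl⟩
          obtain rfl : φ = 0 := hφ _ hx
          refine ⟨_, hstab _ _ _ hx, ?_⟩
          change g * ω - 0 * _ = g * ω
          rw [zero_mul, sub_zero]
      · push Not at hχ
        obtain ⟨x, hx, hx0⟩ := hχ
        refine Hol.exists_eq_smul_one_of_mul_mem hU.isPreconnected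
          (N.map (LinearMap.fst ℂ _ _ ∘ₗ LinearMap.snd ℂ _ _)) ?_ ?_
        · rw [Submodule.ne_bot_iff]
          exact ⟨x.2.1, ⟨x, hx, rfl⟩, hx0⟩
        · rintro _ ⟨⟨φ, χ, ω⟩, hx, rfl⟩
          refine ⟨_, N.neg_mem (hstab _ _ _ hx), ?_⟩
          exact neg_neg (g * χ)
    · push Not at hφ
      obtain ⟨x, hx, hx0⟩ := hφ
      refine Hol.exists_eq_smul_one_of_mul_mem hU.isPreconnected
        (N.map (LinearMap.fst ℂ _ _)) ?_ ?_
      · rw [Submodule.ne_bot_iff]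
        exact ⟨x.1, ⟨x, hx, rfl⟩, hx0⟩
      · rintro _ ⟨⟨φ, χ, ω⟩, hx, rfl⟩
        exact ⟨_, hstab _ _ _ hx, rfl⟩

theorem evenOp_mem_evenPart_iff {s : Submodule ℂ (Op U)} {f g h : Hol U} :
    evenOp f g h ∈ evenPart s ↔ (f, g, h) ∈ coeffSpace s :=
  ⟨fun hx => hx.1, fun hx => ⟨hx, f, g, h, rfl⟩⟩

theorem regular_mem_codiscreteWithin (hU : IsConnected (U : Set ℂ)) (L : Submodule ℂ (Op U)) :
    {z : ℂ | ∃ hz : z ∈ U, IsRegularPoint L ⟨z, hz⟩} ∈ Filter.codiscreteWithin (U : Set ℂ) := by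
  by_cases h0 : ∀ f g h : Hol U, evenOp f g h ∈ L → f = 0
  · exact Filter.mem_of_superset (Filter.self_mem_codiscreteWithin _)
      fun z hz => ⟨hz, Or.inl h0⟩
  · push Not at h0
    obtain ⟨f, g, h, hx, hf⟩ := h0
    obtain ⟨x, hfx⟩ : ∃ x : U, f x ≠ 0 := by
      by_contra! hcon
      exact hf (Hol.ext hcon)
    have hmem := (analyticOnNhd_extendZero f).preimage_zero_mem_codiscreteWithin
      (x := (x : ℂ)) (by rwa [extendZero_apply]) x.2 hU
    refine Filter.mem_of_superset
      (Filter.inter_mem hmem (Filter.self_mem_codiscreteWithin _)) ?_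
    rintro z ⟨hz, hzU⟩
    refine ⟨hzU, Or.inr ⟨f, g, h, hx, ?_⟩⟩
    have := extendZero_apply ⇑f ⟨z, hzU⟩
    rw [← this]
    exact hz

/-- Local normal forms of an admissible space of coefficients on a disc that contains an operator
with vector field `∂_z`. -/
theorem IsAdmissible.exists_normalForm {W : Opens ℂ} {r : ℝ} (hr : 0 < r)
    (hW : (W : Set ℂ) = Metric.ball 0 r) {N : Submodule ℂ (Coeff W)} (hN : IsAdmissible N)
    {g h : Hol W} (h1 : (1, g, h) ∈ N)
    (hdich : (∀ x ∈ N, ∃ c : ℂ, x.1 = c • (1 : Hol W)) ∨ ∃ g h, (coord W, g, h) ∈ N) :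
    ∃ L : Submodule ℂ (Op W), Equivalent (N.map (evenMap W)) L ∧
      (IsType1 L ∨ IsType2 L ∨ IsType3 L) := by
  have hWc : IsConnected (W : Set ℂ) :=
    hW ▸ (convex_ball (0 : ℂ) r).isConnected (Metric.nonempty_ball.2 hr)
  set N' := N.map (gauge (-g) (-h)) with hN'
  have hadm : IsAdmissible N' := hN.map_gauge _ _
  have heq := equivalent_map_gauge hW (-g) (-h) N
  have h1' : (1, 0, 0) ∈ N' := ⟨_, h1, by
    rw [gauge_apply, one_mul, one_mul, add_neg_cancel, add_neg_cancel]⟩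
  rcases hdich with hc | ⟨g₁, h₁, hz⟩
  · refine ⟨_, heq, Or.inl (hadm.isType1 hWc.isPreconnected h1' ?_)⟩
    rintro _ ⟨x, hx, rfl⟩
    exact hc x hx
  · have hz' : gauge (-g) (-h) (coord W, g₁, h₁) ∈ N' := ⟨_, hz, rfl⟩
    rw [gauge_apply] at hz'
    obtain ⟨ε, γ, n, hε, hI⟩ := hadm.exists_hasPolynomialIdeal hWc.isPreconnected h1' hz'
    obtain ⟨q, p, α, β, h1'', hz''⟩ := hI.exists_gauge hWc.isPreconnected hadm h1' hz'
    exact ⟨_, heq.trans (equivalent_map_gauge hW q p N'),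
      Or.inr ((hI.map_gauge q p).isType2_or_isType3 hWc (hadm.map_gauge q p) hε h1'' hz'')⟩

end Main

end

end SuperDiff

theorem mainTheorem4 (U : TopologicalSpace.Opens ℂ) (hU : IsConnected (U : Set ℂ))
    (s : Submodule ℂ (SuperDiff.Op U)) (hs : SuperDiff.IsGradedSubalgebra s)
    (hfin : FiniteDimensional ℂ s) (hodd : SuperDiff.oddPart s ≠ ⊥) :
    {z : ℂ | ∃ hz : z ∈ U, SuperDiff.IsRegularPoint (SuperDiff.evenPart s) ⟨z, hz⟩} ∈
        Filter.codiscreteWithin (U : Set ℂ) ∧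
      ∀ z₀ : U, SuperDiff.IsRegularPoint (SuperDiff.evenPart s) z₀ →
        ∃ (V : TopologicalSpace.Opens ℂ) (hVU : V ≤ U), (z₀ : ℂ) ∈ V ∧
          ∃ (W : TopologicalSpace.Opens ℂ) (L : Submodule ℂ (SuperDiff.Op W)),
            SuperDiff.Equivalent (SuperDiff.restrictOps hVU (SuperDiff.evenPart s)) L ∧
              (SuperDiff.IsType0 L ∨ SuperDiff.IsType1 L ∨ SuperDiff.IsType2 L ∨
                SuperDiff.IsType3 L) := by
  refine ⟨SuperDiff.regular_mem_codiscreteWithin hU _, fun z₀ hz₀ => ?_⟩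
  have hM := SuperDiff.isAdmissible_coeffSpace hU hs hfin hodd
  have := hM.finiteDimensional
  rcases hz₀ with h0 | ⟨f, g, h, hx, hfz⟩
  -- Without vector fields the algebra is already in normal form on all of `U`, with the identity
  -- transformation.
  · refine ⟨U, le_rfl, z₀.2, U, _, SuperDiff.Equivalent.refl _, Or.inl ?_⟩
    rw [SuperDiff.evenPart_eq_map, SuperDiff.restrictOps_map_evenMap,
      show SuperDiff.resCoeff (le_refl U) = LinearMap.id from rfl, Submodule.map_id]
    exact hM.isType0 fun x hx => h0 _ _ _ (SuperDiff.evenOp_mem_evenPart_iff.2 hx)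
  · rw [SuperDiff.evenOp_mem_evenPart_iff] at hx
    obtain ⟨f₀, ⟨x₀, hx₀, rfl⟩, hf₀, hdich⟩ := SuperDiff.exists_affine_pair hU.isPreconnected
      ((SuperDiff.coeffSpace s).map (LinearMap.fst ℂ _ _))
      (by
        rintro _ ⟨x, hx, rfl⟩ _ ⟨y, hy, rfl⟩
        exact ⟨_, hM.closed _ hx _ hy, rfl⟩) z₀ ⟨f, ⟨_, hx, rfl⟩, hfz⟩
    obtain ⟨V, hVU, hzV, W, r, N, hr, hW, hN, heq, ⟨g₁, h₁, h1⟩, hN'⟩ :=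
      hM.rectify hU z₀ hx₀ hf₀ (hdich.imp
        (fun hc x hx => hc _ ⟨x, hx, rfl⟩)
        (fun ⟨_, ⟨x₁, hx₁, e⟩, hz, hw⟩ => ⟨x₁, hx₁, by subst e; exact ⟨hz, hw⟩⟩))
    obtain ⟨L, hL, htype⟩ := hN.exists_normalForm hr hW h1 hN'
    refine ⟨V, hVU, hzV, W, L, ?_, Or.inr htype⟩
    rw [SuperDiff.evenPart_eq_map]
    exact heq.trans hL
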